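/- Let $n\ge 2$. There is a function $\alpha$, depending only on $n$, which assigns to every real $\mu>0$ a constant $\alpha(\mu)>0$, such that the following holds. Let $X$ be a pure $n$-dimensional, $(n+1)$-partite simplicial complex with sides $S_0,\dots,S_n$ (disjoint sets of vertices such that every $n$-simplex has exactly one vertex in each $S_i$), and for a simplex $\tau$ put $\operatorname{type}(\tau)=\{i:\tau\cap S_i\neq\emptyset\}$. Let $X_\tau=\{\eta\in X:\eta\cap\tau=\emptyset,\ \eta\cup\tau\in X\}$ denote the link of $\tau$ (so $X_\emptyset=X$). Let $G$ be a group, and assume that the pair $(X,G)$ satisfies: (B1) all $1$-dimensional links are finite; (B2) all links of dimension $d\ge 1$, including $X$, are gallery connected: any two $d$-simplices are joined by a sequence of $d$-simplices in which consecutive ones meet in a $(d-1)$-simplex; (B3) every link, including $X$, is finite or contractible; (B4) $G$ acts simplicially on $X$, preserving types, and transitively on the $n$-simplices. For $i\ne j$ let $\lambda_{i,j}$ be the second largest eigenvalue (counted with multiplicity) of the simple random walk on the finite graph $X_\tau$, where $\tau$ is any $(n-2)$-simplex with $\operatorname{type}(\tau)=\{0,\dots,n\}\setminus\{i,j\}$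 (by (B4) the choice of $\tau$ is irrelevant). The cosine matrix $A=A(X)$ is the $(n+1)\times(n+1)$ matrix with $A_{i,i}=1$ and $A_{i,j}=-\lambda_{i,j}$ for $i\neq j$. Assume that $A(X)$ is positive definite, let $\mu>0$ be its smallest eigenvalue, and let $\triangle=\{x_0,\dots,x_n\}$, $x_i\in S_i$, be an $n$-simplex of $X$. Let $\pi$ be a unitary representation of $G$ on a complex Hilbert space $\mathcal H$ without non-zero invariant vectors, and let $\phi$ be a map from the vertices of $X$ to $\mathcal H$ which is an equivariant embedding of $X$ into the unit sphere of $\mathcal H$, that is: 1. $\|\phi(x)\|=1$ for every vertex $x$; 2. $\phi(g.x)=\pi(g)\phi(x)$ for every $g\in G$ and every vertex $x$; 3. for all $i\ne j$, with $\triangle_{i,j}=\{x_k: k\neq i,j\}$, the orthogonal projection of $\phi(x_i)$ to the subspace of vectors fixed by the stabilizer $G_{\triangle_{i,j}}$ of $\triangle_{i,j}$ belongs to $\operatorname{span}_{\mathbb C}\{\phi(x):x\in\triangle_{i,j}\}$. Then $\phi(x_0),\dots,\phi(x_n)$ are linearly independent over $\mathbb C$. Hence they are the vertices of an $n$-dimensional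 spherical simplex, namely the set of unit vectors $\sum_k t_k\phi(x_k)$ with all $t_k\ge 0$. The $n$-dimensional spherical volume of this simplex is at least $\alpha(\mu)$; here the volume is the surface measure of the unit sphere of the $(n+1)$-dimensional real span of $\phi(x_0),\dots,\phi(x_n)$, taken with respect to the inner product $\operatorname{Re}\langle\cdot,\cdot\rangle$. -/

import Mathlib

noncomputable section

namespace PartiteComplex

open scoped Pointwise ENNReal

/-! ### Simplicial complexes

A simplex of dimension `d` is a face with `d + 1` vertices. Faces of Mathlib's complexes are
nonempty; the empty simplex, of dimension `-1`, is treated separately below. -/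

section Complexes

variable {V : Type*}

/-- The link of `τ` in `X`; for `τ = ∅` it is `X` itself. -/
def link [DecidableEq V] (X : AbstractSimplicialComplex V) (τ : Finset V) :
    PreAbstractSimplicialComplex V where
  faces := {η | η.Nonempty ∧ Disjoint η τ ∧ η ∪ τ ∈ X.faces}
  isRelLowerSet_faces := by
    rintro η ⟨hne, hd, hX⟩
    refine ⟨hne, fun θ hθ hθne => ⟨hθne, hd.mono_left hθ, ?_⟩⟩
    exact (X.isRelLowerSet_faces hX).2 (Finset.union_subset_union_left hθ)
      (hθne.mono Finset.subset_union_left)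

/-- `K` is pure of dimension `d`. -/
def IsPure (K : PreAbstractSimplicialComplex V) (d : ℕ) : Prop :=
  (∃ σ ∈ K.faces, σ.card = d + 1) ∧
    ∀ η ∈ K.faces, ∃ σ ∈ K.faces, σ.card = d + 1 ∧ η ⊆ σ

/-- Any two `d`-dimensional simplices are joined by a sequence of `d`-dimensional simplices in
which consecutive ones meet in a simplex of dimension `d - 1`. -/
def IsGalleryConnected [DecidableEq V] (K : PreAbstractSimplicialComplex V) (d : ℕ) : Prop :=
  ∀ σ ∈ K.faces, ∀ σ' ∈ K.faces, σ.card = d + 1 → σ'.card = d + 1 →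
    Relation.ReflTransGen
      (fun a b : Finset V => (a ∈ K.faces ∧ a.card = d + 1) ∧ (b ∈ K.faces ∧ b.card = d + 1) ∧
        (a ∩ b).card = d) σ σ'

/-- `S 0, …, S n` are the sides of the complex `X`: they are disjoint, and each `n`-dimensional
simplex has exactly one vertex in each of them. -/
def IsPartite {n : ℕ} (X : AbstractSimplicialComplex V) (S : Fin (n + 1) → Set V) : Prop :=
  Pairwise (fun i j => Disjoint (S i) (S j)) ∧
    ∀ σ ∈ X.faces, σ.card = n + 1 → ∀ i, ∃! v, v ∈ σ ∧ v ∈ S i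

/-- The type of a simplex. -/
def faceType {n : ℕ} (S : Fin (n + 1) → Set V) (τ : Finset V) : Set (Fin (n + 1)) :=
  {i | ∃ v ∈ τ, v ∈ S i}

/-- The points of the geometric realization of `K`, in barycentric coordinates. -/
def Realization (K : PreAbstractSimplicialComplex V) : Type _ :=
  {f : V → ℝ // ∃ σ ∈ K.faces, (∀ v, 0 ≤ f v) ∧ (∀ v, v ∉ σ → f v = 0) ∧ ∑ v ∈ σ, f v = 1}

/-- The closed geometric simplex spanned by the face `σ`, with its Euclidean topology. -/
def ClosedCell (σ : Finset V) : Type _ :=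
  {f : V → ℝ // (∀ v, 0 ≤ f v) ∧ (∀ v, v ∉ σ → f v = 0) ∧ ∑ v ∈ σ, f v = 1}

instance (σ : Finset V) : TopologicalSpace (ClosedCell σ) :=
  inferInstanceAs (TopologicalSpace {f : V → ℝ //
    (∀ v, 0 ≤ f v) ∧ (∀ v, v ∉ σ → f v = 0) ∧ ∑ v ∈ σ, f v = 1})

/-- The inclusion of a closed simplex into the realization. -/
def cellMap (K : PreAbstractSimplicialComplex V) (σ : K.faces) :
    ClosedCell σ.1 → Realization K :=
  fun f => ⟨f.1, σ.1, σ.2, f.2⟩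

/-- The weak topology: a set is open if and only if its trace on every closed simplex is open. -/
instance (K : PreAbstractSimplicialComplex V) : TopologicalSpace (Realization K) :=
  ⨆ σ : K.faces, TopologicalSpace.coinduced (cellMap K σ) inferInstance

end Complexes

/-! ### The simple random walk and the cosine matrix -/

/-- The random walk operator of a finite graph. -/
def randomWalk {W : Type*} (Γ : SimpleGraph W) (φ : W → ℝ) (v : W) : ℝ :=
  (∑ᶠ u ∈ Γ.neighborSet v, φ u) / (Γ.neighborSet v).ncard

/-- The second largest eigenvalue of the random walk of a finite graph, eigenvalues being counted
with multiplicity: the largest `t` for which there are linearly independent eigenfunctions `φ`,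
`ψ` with eigenvalues `t` and `s ≥ t`. -/
def secondEigenvalue {W : Type*} (Γ : SimpleGraph W) : ℝ :=
  sSup {t : ℝ | ∃ s : ℝ, t ≤ s ∧ ∃ φ ψ : W → ℝ, LinearIndependent ℝ ![φ, ψ] ∧
    randomWalk Γ φ = t • φ ∧ randomWalk Γ ψ = s • ψ}

/-- The `1`-skeleton of a complex, as a graph on its vertices. -/
def skeletonGraph {V : Type*} [DecidableEq V] (K : PreAbstractSimplicialComplex V) :
    SimpleGraph {v : V // {v} ∈ K.faces} where
  Adj v w := v ≠ w ∧ {v.1, w.1} ∈ K.faces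
  symm := ⟨fun v w h => ⟨h.1.symm, by rw [Finset.pair_comm]; exact h.2⟩⟩
  loopless := ⟨fun _ h => h.1 rfl⟩

open Classical in
/-- The number `λ i j`: the second largest eigenvalue of the random walk on the link of a simplex
`τ` of dimension `n - 2` whose type is the complement of `{i, j}`. Under the assumptions of
`IsBPair` below, it does not depend on the choice of `τ`. -/
def linkEigenvalue {V : Type*} [DecidableEq V] {n : ℕ} (X : AbstractSimplicialComplex V)
    (S : Fin (n + 1) → Set V) (i j : Fin (n + 1)) : ℝ :=
  if h : ∃ τ ∈ X.faces, τ.card + 1 = n ∧ faceType S τ = {i, j}ᶜ then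
    secondEigenvalue (skeletonGraph (link X h.choose))
  else 0

/-- The cosine matrix `A(X)`. -/
def cosineMatrix {V : Type*} [DecidableEq V] {n : ℕ} (X : AbstractSimplicialComplex V)
    (S : Fin (n + 1) → Set V) : Matrix (Fin (n + 1)) (Fin (n + 1)) ℝ :=
  Matrix.of fun i j => if i = j then 1 else -linkEigenvalue X S i j

/-! ### The assumptions on the pair `(X, G)` -/

/-- `X` is a pure `n`-dimensional, `(n+1)`-partite complex with sides `S 0, …, S n`, and the pair
`(X, G)` satisfies the conditions (B1)-(B4). -/
structure IsBPair {V : Type*} [DecidableEq V] {n : ℕ} (G : Type*) [Group G] [MulAction G V]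
    (X : AbstractSimplicialComplex V) (S : Fin (n + 1) → Set V) : Prop where
  pure : IsPure X.toPreAbstractSimplicialComplex n
  partite : IsPartite X S
  /-- (B1): the links of dimension `1` are finite. -/
  finite_links : ∀ τ ∈ X.faces, τ.card + 1 = n → (link X τ).faces.Finite
  /-- (B2): the links of dimension `d ≥ 1`, including `X` itself, are gallery connected. -/
  gallery_links : ∀ τ, τ = ∅ ∨ τ ∈ X.faces → ∀ d, 1 ≤ d → τ.card + d = n →
    IsGalleryConnected (link X τ) d
  /-- (B3): the links, including `X` itself, are finite or contractible. -/
  finite_or_contractible : ∀ τ, τ = ∅ ∨ τ ∈ X.faces →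
    (link X τ).faces.Finite ∨ ContractibleSpace (Realization (link X τ))
  /-- (B4): the action is simplicial, type preserving, and transitive on `n`-simplices. -/
  smul_mem : ∀ (g : G), ∀ τ ∈ X.faces, g • τ ∈ X.faces
  type_smul : ∀ (g : G), ∀ τ ∈ X.faces, faceType S (g • τ) = faceType S τ
  transitive : ∀ σ ∈ X.faces, ∀ σ' ∈ X.faces, σ.card = n + 1 → σ'.card = n + 1 →
    ∃ g : G, g • σ = σ'

/-! ### The entries of the cosine matrix are well defined -/

section WellDefined

theorem randomWalk_comp_iso {W W' : Type*} {Γ : SimpleGraph W} {Γ' : SimpleGraph W'} (e : Γ ≃g Γ')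
    {φ : W' → ℝ} {t : ℝ} (h : randomWalk Γ' φ = t • φ) :
      randomWalk Γ (φ ∘ e) = t • (φ ∘ e) := by
  funext v
  have h1 := congrFun h (e v)
  simp only [randomWalk, Pi.smul_apply, Function.comp] at h1 ⊢
  rw [← h1]
  have hN : Γ'.neighborSet (e v) = e '' Γ.neighborSet v := by
    ext w
    constructor
    · intro hw
      exact ⟨e.symm w, by
        have := e.symm.map_adj_iff.mpr hw
        simpa using this, by simp⟩
    · rintro ⟨u, hu, rfl⟩
      exact e.map_adj_iff.mpr hu
  rw [hN, Set.ncard_image_of_injective _ e.injective, finsum_mem_image e.injective.injOn]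

theorem secondEigenvalue_iso {W W' : Type*} {Γ : SimpleGraph W} {Γ' : SimpleGraph W'} (e : Γ ≃g Γ') :
    secondEigenvalue Γ = secondEigenvalue Γ' := by
  unfold secondEigenvalue
  congr 1
  ext t
  constructor
  · rintro ⟨s, hs, φ, ψ, h, h1, h2⟩
    refine ⟨s, hs, φ ∘ e.symm, ψ ∘ e.symm, ?_, randomWalk_comp_iso _ h1, randomWalk_comp_iso _ h2⟩
    rw [LinearIndependent.pair_iff] at h ⊢
    intro a b hst
    apply h
    funext w
    simpa using congrFun hst (e w)
  · rintro ⟨s, hs, φ, ψ, h, h1, h2⟩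
    refine ⟨s, hs, φ ∘ e, ψ ∘ e, ?_, randomWalk_comp_iso _ h1, randomWalk_comp_iso _ h2⟩
    rw [LinearIndependent.pair_iff] at h ⊢
    intro a b hst
    apply h
    funext w
    simpa using congrFun hst (e.symm w)

variable {V : Type*} [DecidableEq V] {n : ℕ} {G : Type*} [Group G] [MulAction G V]
  {X : AbstractSimplicialComplex V} {S : Fin (n + 1) → Set V}

theorem mem_link_smul (h : IsBPair G X S) (g : G) (τ η : Finset V) (hη : η ∈ (link X τ).faces) :
    g • η ∈ (link X (g • τ)).faces := by
  obtain ⟨h1, h2, h3⟩ := hη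
  refine ⟨h1.smul_finset, ?_, ?_⟩
  · rw [Finset.disjoint_left] at h2 ⊢
    intro a ha hb
    rw [← Finset.inv_smul_mem_iff] at ha hb
    exact h2 ha hb
  · rw [← Finset.smul_finset_union]
    exact h.smul_mem g _ h3

/-- The isomorphism of links induced by a group element. -/
def linkIso (h : IsBPair G X S) (g : G) (τ : Finset V) :
    skeletonGraph (link X τ) ≃g skeletonGraph (link X (g • τ)) where
  toFun v := ⟨g • v.1, by simpa using mem_link_smul h g τ _ v.2⟩
  invFun v := ⟨g⁻¹ • v.1, by simpa using mem_link_smul h g⁻¹ _ _ v.2⟩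
  left_inv v := by simp
  right_inv v := by simp
  map_rel_iff' := by
    intro a b
    simp only [skeletonGraph, Equiv.coe_fn_mk, ne_eq, Subtype.ext_iff]
    refine and_congr (by simp) ⟨fun H => ?_, fun H => ?_⟩
    · have := mem_link_smul h g⁻¹ _ _ H
      simpa [Finset.smul_finset_insert] using this
    · have := mem_link_smul h g _ _ H
      simpa [Finset.smul_finset_insert] using this

theorem mem_iff_type (h : IsBPair G X S) {σ τ : Finset V} (hσ : σ ∈ X.faces)
    (hc : σ.card = n + 1) (hτ : τ ⊆ σ) (v : V) :
    v ∈ τ ↔ v ∈ σ ∧ ∃ i ∈ faceType S τ, v ∈ S i := by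
  have hcol : ∀ v ∈ σ, ∃ i, v ∈ S i := by
    have hu := h.partite.2 σ hσ hc
    choose f hf hf' using hu
    have inj : Function.Injective f := by
      intro i j hij
      by_contra hne
      exact Set.disjoint_left.mp (h.partite.1 hne) (hf i).2 (hij ▸ (hf j).2)
    have : Finset.univ.image f = σ := by
      apply Finset.eq_of_subset_of_card_le
      · intro w hw
        obtain ⟨i, -, rfl⟩ := Finset.mem_image.mp hw
        exact (hf i).1
      · rw [Finset.card_image_of_injective _ inj, hc]; simp
    intro v hv
    rw [← this] at hv
    obtain ⟨i, -, rfl⟩ := Finset.mem_image.mp hv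
    exact ⟨i, (hf i).2⟩
  constructor
  · intro hv
    obtain ⟨i, hi⟩ := hcol v (hτ hv)
    exact ⟨hτ hv, i, ⟨v, hv, hi⟩, hi⟩
  · rintro ⟨hv, i, ⟨w, hw, hwi⟩, hvi⟩
    have := (h.partite.2 σ hσ hc i).unique ⟨hv, hvi⟩ ⟨hτ hw, hwi⟩
    exact this ▸ hw

/-- The number `λ i j` may be computed in the link of any simplex of the right type. -/
theorem linkEigenvalue_eq (h : IsBPair G X S) {i j : Fin (n + 1)} {τ : Finset V}
    (hτ : τ ∈ X.faces) (hc : τ.card + 1 = n) (ht : faceType S τ = {i, j}ᶜ) :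
    linkEigenvalue X S i j = secondEigenvalue (skeletonGraph (link X τ)) := by
  have hex : ∃ τ ∈ X.faces, τ.card + 1 = n ∧ faceType S τ = {i, j}ᶜ := ⟨τ, hτ, hc, ht⟩
  rw [linkEigenvalue, dif_pos hex]
  obtain ⟨h1, h2, h3⟩ := hex.choose_spec
  generalize hex.choose = τ' at h1 h2 h3
  obtain ⟨σ, hσ, hσc, hs⟩ := h.pure.2 τ hτ
  obtain ⟨σ', hσ', hσc', hs'⟩ := h.pure.2 τ' h1
  obtain ⟨g, rfl⟩ := h.transitive σ' hσ' σ hσ hσc' hσc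
  have : g • τ' = τ := by
    ext v
    rw [mem_iff_type h hσ hσc hs, mem_iff_type h hσ hσc (Finset.smul_finset_subset_smul_finset hs'),
      h.type_smul g τ' h1, h3, ht]
  rw [← this]
  exact secondEigenvalue_iso (linkIso h g τ')

end WellDefined

/-! ### Unitary representations and equivariant embeddings -/

section Representations

variable {G : Type*} [Group G] {H : Type*} [NormedAddCommGroup H] [InnerProductSpace ℂ H]

/-- The subspace of the vectors fixed by a subgroup `K` of `G`. -/
def fixedSubspace (π : G →* (H ≃ₗᵢ[ℂ] H)) (K : Subgroup G) : Submodule ℂ H where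
  carrier := {v | ∀ g ∈ K, π g v = v}
  add_mem' ha hb g hg := by rw [map_add, ha g hg, hb g hg]
  zero_mem' _ _ := map_zero _
  smul_mem' c v hv g hg := by rw [map_smul, hv g hg]

theorem isClosed_fixedSubspace (π : G →* (H ≃ₗᵢ[ℂ] H)) (K : Subgroup G) :
    IsClosed (fixedSubspace π K : Set H) := by
  have h : (fixedSubspace π K : Set H) = ⋂ g ∈ K, {v : H | π g v = v} := by
    ext v
    simp [fixedSubspace]
  rw [h]
  exact isClosed_biInter fun g _ => isClosed_eq (π g).continuous continuous_id

instance [CompleteSpace H] (π : G →* (H ≃ₗᵢ[ℂ] H)) (K : Subgroup G) :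
    (fixedSubspace π K).HasOrthogonalProjection := by
  have : CompleteSpace (fixedSubspace π K) := (isClosed_fixedSubspace π K).completeSpace_coe
  infer_instance

/-- The representation has no invariant vector other than `0`. -/
def NoInvariantVectors (π : G →* (H ≃ₗᵢ[ℂ] H)) : Prop :=
  ∀ v : H, (∀ g, π g v = v) → v = 0

variable {V : Type*} [DecidableEq V] [MulAction G V] {n : ℕ}

/-- `x 0, …, x n` are the vertices of a chamber, numbered by their sides. -/
def IsChamber (X : AbstractSimplicialComplex V) (S : Fin (n + 1) → Set V)
    (x : Fin (n + 1) → V) : Prop :=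
  Finset.univ.image x ∈ X.faces ∧ ∀ i, x i ∈ S i

/-- The face of the chamber `x` that is opposite to its vertices `x i` and `x j`. -/
def oppositeFace (x : Fin (n + 1) → V) (i j : Fin (n + 1)) : Finset V :=
  ({i, j}ᶜ : Finset (Fin (n + 1))).image x

/-- The map `φ` on the vertices is an equivariant embedding into the unit sphere of `H`
(with respect to the chamber `x`). -/
structure IsEquivariantEmbedding [CompleteSpace H] (π : G →* (H ≃ₗᵢ[ℂ] H))
    (x : Fin (n + 1) → V) (φ : V → H) : Prop where
  norm_eq : ∀ v, ‖φ v‖ = 1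
  equivariant : ∀ (g : G) (v : V), φ (g • v) = π g (φ v)
  projection_mem : ∀ i j, i ≠ j →
    (fixedSubspace π (MulAction.stabilizer G (oppositeFace x i j))).starProjection (φ (x i)) ∈
      Submodule.span ℂ (φ '' (oppositeFace x i j : Set V))

end Representations

/-! ### Spherical simplices -/

section Spherical

variable {m : ℕ}

section Real

variable {E : Type*} [NormedAddCommGroup E] [InnerProductSpace ℝ E]

/-- The spherical simplex with vertices `v i`: the unit vectors in the convex cone spanned by
the `v i`. -/
def sphericalSimplex (v : Fin m → E) : Set E :=
  {u | ‖u‖ = 1 ∧ ∃ t : Fin m → ℝ, (∀ i, 0 ≤ t i) ∧ u = ∑ i, t i • v i}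

/-- The volume of the spherical simplex with vertices `v i` with respect to the surface measure of
the unit sphere of the real span of the `v i`. -/
def sphericalVolume (v : Fin m → E) : ℝ≥0∞ :=
  letI : MeasurableSpace (Submodule.span ℝ (Set.range v)) := borel _
  haveI : BorelSpace (Submodule.span ℝ (Set.range v)) := ⟨rfl⟩
  haveI : FiniteDimensional ℝ (Submodule.span ℝ (Set.range v)) :=
    FiniteDimensional.span_of_finite ℝ (Set.finite_range v)
  (MeasureTheory.volume : MeasureTheory.Measure (Submodule.span ℝ (Set.range v))).toSphere
    {u | ((u : Submodule.span ℝ (Set.range v)) : E) ∈ sphericalSimplex v}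

end Real

/-- The spherical volume in the unit sphere of a complex Hilbert space `H`, which is regarded as a
real Hilbert space with the inner product `Re ⟪·, ·⟫`. -/
def complexSphericalVolume {H : Type*} [NormedAddCommGroup H] [InnerProductSpace ℂ H]
    (v : Fin m → H) : ℝ≥0∞ :=
  letI : InnerProductSpace ℝ H := InnerProductSpace.rclikeToReal ℂ H
  sphericalVolume v

end Spherical

end PartiteComplex

end

/-! Write `v i` for `φ (x i)`. The `v i` are independent: if `v i` lay in the span of the others,
the pointwise stabilizer of each panel of the chamber would fix it, either because it fixes `x i` or
because it fixes all the other vertices. Gallery connectedness of `X` makes these stabilizers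
generate `G` (`invariant_of_fixed_panels`), so the unit vector `v i` would be invariant.

For the volume, let `u i` be the dual basis inside the span. For `i ≠ j` let `P` be the projection
to the vectors fixed by the stabilizer of the face opposite to `x i` and `x j`. By the third
condition on an embedding, `P` preserves the span of the `v k`, and this forces `u i` and `u j` into
the plane of `v i - P (v i)` and `v j - P (v j)`, where they form the dual basis of these two
vectors. Dual bases of a plane have, up to sign, the same cosine (`norm_inner_dual_le`).

That cosine is at most `λ i j` (`norm_inner_sub_starProjection_le`): the two vectors, rescaled
freely, spread by equivariance to a function of mean zero on the link, and the spectral gap applies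
to it.

Hence the normalized Gram matrix of the `u i` has off-diagonal entries of modulus at most `λ i j`.
Expanding `1 = ‖v i‖ ^ 2` in the dual basis gives `μ * ‖u i‖ ^ 2 ≤ 1` (`norm_dual_le`). So the
coordinates of a vector are bounded by `1 / √μ` times its norm, and the cone over the simplex
contains a ball of definite radius (`le_sphericalVolume`). -/

open scoped Pointwise ENNReal

namespace PartiteComplex

/-! ### Volume of a spherical simplex from a ball in its cone. -/

section SphericalVolume

open MeasureTheory Metric

variable {E : Type*} [NormedAddCommGroup E] [InnerProductSpace ℝ E]

/-- If the coordinates of a point with respect to the unit vectors `v i` are bounded by `δ⁻¹` times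
its norm, then the spherical simplex with vertices `v i` is not too small. -/
theorem le_sphericalVolume {m : ℕ} (hm : 0 < m) (v : Fin m → E) (hv : ∀ i, ‖v i‖ = 1) {δ : ℝ}
    (hδ : 0 < δ) (h : ∀ (t : Fin m → ℝ) (i : Fin m), δ * |t i| ≤ ‖∑ k, t k • v k‖) :
    (m : ℝ≥0∞) * (ENNReal.ofReal (δ / (2 * m)) ^ m *
      ENNReal.ofReal (√Real.pi ^ m / Real.Gamma ((m : ℝ) / 2 + 1))) ≤ sphericalVolume v := by
  classical
  have hli : LinearIndependent ℝ v := by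
    rw [Fintype.linearIndependent_iff]
    intro t ht i
    have := h t i
    rw [ht, norm_zero] at this
    have h0 : |t i| ≤ 0 := by
      by_contra hc
      push Not at hc
      exact absurd (mul_pos hδ hc) (not_lt.mpr this)
    exact abs_nonpos_iff.mp h0
  have hmR : (0 : ℝ) < m := by exact_mod_cast hm
  unfold sphericalVolume
  let W := Submodule.span ℝ (Set.range v)
  let _ : MeasurableSpace W := borel _
  have : BorelSpace W := ⟨rfl⟩
  have : FiniteDimensional ℝ W := FiniteDimensional.span_of_finite ℝ (Set.finite_range v)
  have hdim : Module.finrank ℝ W = m := by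
    rw [finrank_span_eq_card hli, Fintype.card_fin]
  have : Nontrivial W := Module.nontrivial_of_finrank_pos (R := ℝ) (by omega)
  -- All coordinates of the centre `p` are `1 / (2 * m)`, and moving by less than `r` changes each
  -- by less than `1 / (2 * m)`. They stay in `(0, 1 / m)`: positivity keeps the ball in the cone,
  -- the upper bound keeps it in the unit ball.
  let r : ℝ := δ / (2 * m)
  let p : W := ⟨∑ k, (1 / (2 * m) : ℝ) • v k,
    Submodule.sum_mem _ fun k _ => Submodule.smul_mem _ _ (Submodule.subset_span ⟨k, rfl⟩)⟩
  have hball : ∀ u ∈ ball p r, ∃ t : Fin m → ℝ, (∀ k, 0 < t k ∧ t k < 1 / m) ∧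
      (u : E) = ∑ k, t k • v k := by
    intro u hu
    obtain ⟨t, ht⟩ := (Submodule.mem_span_range_iff_exists_fun ℝ).mp u.2
    refine ⟨t, fun k => ?_, ht.symm⟩
    have h1 := h (fun k => t k - 1 / (2 * m)) k
    have h2 : ∑ k, (t k - 1 / (2 * m)) • v k = (u : E) - p := by
      simp only [sub_smul, Finset.sum_sub_distrib, ht, p]
    rw [h2] at h1
    have h3 : ‖(u : E) - p‖ < r := by
      rw [mem_ball, dist_eq_norm] at hu
      exact hu
    have h4 : |t k - 1 / (2 * m)| < 1 / (2 * m) := by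
      have : δ * |t k - 1 / (2 * m)| < δ * (1 / (2 * m)) := by
        refine h1.trans_lt (h3.trans_eq ?_)
        simp only [r]; ring
      exact lt_of_mul_lt_mul_left this hδ.le
    rw [abs_lt] at h4
    have h5 : (1 : ℝ) / m = 1 / (2 * m) + 1 / (2 * m) := by field_simp; norm_num
    constructor <;> linarith [h4.1, h4.2]
  have hne : ∀ u ∈ ball p r, u ≠ 0 := by
    rintro u hu rfl
    obtain ⟨t, ht, h0⟩ := hball _ hu
    have := Fintype.linearIndependent_iff.mp hli t h0.symm ⟨0, hm⟩
    exact (ht ⟨0, hm⟩).1.ne' this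
  have hlt : ∀ u ∈ ball p r, ‖u‖ < 1 := by
    intro u hu
    obtain ⟨t, ht, h0⟩ := hball _ hu
    have : Nonempty (Fin m) := ⟨⟨0, hm⟩⟩
    calc ‖u‖ = ‖∑ k, t k • v k‖ := by rw [← h0]; rfl
      _ ≤ ∑ k, ‖t k • v k‖ := norm_sum_le _ _
      _ = ∑ k, t k := by
        refine Finset.sum_congr rfl fun k _ => ?_
        rw [norm_smul, hv, mul_one, Real.norm_of_nonneg (ht k).1.le]
      _ < ∑ _k : Fin m, (1 / m : ℝ) :=
        Finset.sum_lt_sum_of_nonempty Finset.univ_nonempty fun k _ => (ht k).2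
      _ = 1 := by simp [hmR.ne']
  -- The radial projection of the ball, written as a union of open sets so that it is visibly
  -- measurable.
  let s : Set (sphere (0 : W) 1) := ⋃ c ∈ Set.Ioi (0 : ℝ), {u | c • (u : W) ∈ ball p r}
  have hs : IsOpen s := isOpen_biUnion fun c _ =>
    isOpen_ball.preimage (continuous_subtype_val.const_smul c)
  have hsub : s ⊆ {u | ((u : W) : E) ∈ sphericalSimplex v} := by
    intro u hu
    simp only [s, Set.mem_iUnion] at hu
    obtain ⟨c, hc, hu⟩ := hu
    obtain ⟨t, ht, h0⟩ := hball _ hu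
    have hc' : 0 < c := hc
    refine ⟨mem_sphere_zero_iff_norm.mp u.2, fun k => c⁻¹ * t k,
      fun k => mul_nonneg (inv_nonneg.mpr hc'.le) (ht k).1.le, ?_⟩
    simp only [mul_smul, ← Finset.smul_sum, ← h0]
    simp [smul_smul, hc'.ne']
  have hcone : ball p r ⊆ Set.Ioo (0 : ℝ) 1 • ((↑) '' s : Set W) := by
    intro u hu
    have hn : 0 < ‖u‖ := norm_pos_iff.mpr (hne u hu)
    have hnorm : ‖(‖u‖⁻¹ : ℝ) • u‖ = 1 := by
      rw [norm_smul, norm_inv, norm_norm, inv_mul_cancel₀ hn.ne']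
    have huu : ‖u‖ • ((‖u‖⁻¹ : ℝ) • u) = u := by
      rw [smul_smul, mul_inv_cancel₀ hn.ne', one_smul]
    refine Set.mem_smul.mpr ⟨‖u‖, ⟨hn, hlt u hu⟩, (‖u‖⁻¹ : ℝ) • u, ?_, huu⟩
    refine ⟨⟨(‖u‖⁻¹ : ℝ) • u, mem_sphere_zero_iff_norm.mpr hnorm⟩, ?_, rfl⟩
    simp only [s, Set.mem_iUnion]
    exact ⟨‖u‖, hn, by simpa only [Set.mem_ofPred_eq, huu] using hu⟩
  -- The surface measure of `s` is the dimension times the volume of the truncated cone over `s`,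
  -- which contains the ball.
  calc (m : ℝ≥0∞) * (ENNReal.ofReal (δ / (2 * m)) ^ m *
      ENNReal.ofReal (√Real.pi ^ m / Real.Gamma ((m : ℝ) / 2 + 1)))
      = m * volume (ball p r) := by rw [InnerProductSpace.volume_ball, hdim]
    _ ≤ m * volume (Set.Ioo (0 : ℝ) 1 • ((↑) '' s : Set W)) := by gcongr
    _ = (volume : Measure W).toSphere s := by
      rw [Measure.toSphere_apply' _ hs.measurableSet, hdim]
    _ ≤ _ := measure_mono hsub

end SphericalVolume

/-! ### Dual bases: norms and angles. -/

section DualBasis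

variable {H : Type*} [NormedAddCommGroup H] [InnerProductSpace ℂ H]
variable {ι : Type*}

open scoped InnerProductSpace

theorem eq_zero_of_mem_span_of_inner_eq_zero {v : ι → H} {y : H}
    (hy : y ∈ Submodule.span ℂ (Set.range v)) (h : ∀ k, ⟪v k, y⟫_ℂ = 0) : y = 0 := by
  have : y ∈ (Submodule.span ℂ (Set.range v))ᗮ := by
    rw [Submodule.mem_orthogonal]
    intro z hz
    induction hz using Submodule.span_induction with
    | mem x hx => obtain ⟨k, rfl⟩ := hx; exact h k
    | zero => simp
    | add a b _ _ ha hb => rw [inner_add_left, ha, hb, add_zero]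
    | smul c a _ ha => rw [inner_smul_left, ha, mul_zero]
  exact (Submodule.disjoint_def.mp (Submodule.orthogonal_disjoint _)) y hy this

variable [Fintype ι] [DecidableEq ι]

/-- Riesz representation of the coordinate functionals, carried out inside the finite-dimensional
span so that the dual vectors lie there. -/
theorem exists_dual_family {v : ι → H} (hv : LinearIndependent ℂ v) :
    ∃ u : ι → H, (∀ i, u i ∈ Submodule.span ℂ (Set.range v)) ∧
      ∀ i j, ⟪u i, v j⟫_ℂ = if i = j then 1 else 0 := by
  let W := Submodule.span ℂ (Set.range v)
  have : FiniteDimensional ℂ W := FiniteDimensional.span_of_finite ℂ (Set.finite_range v)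
  let b : Module.Basis ι ℂ W := Module.Basis.span hv
  refine ⟨fun i => ((InnerProductSpace.toDual ℂ W).symm (b.coord i).toContinuousLinearMap : W),
    fun i => Subtype.property _, fun i j => ?_⟩
  have hb : v j = (b j : H) := by exact (congrArg Subtype.val (Module.Basis.span_apply hv j)).symm
  rw [hb, ← Submodule.coe_inner, InnerProductSpace.toDual_symm_apply]
  simp [Finsupp.single_apply, eq_comm]

theorem eq_sum_inner_dual_smul {v u : ι → H}
    (huv : ∀ i j, ⟪u i, v j⟫_ℂ = if i = j then 1 else 0) {y : H}
    (hy : y ∈ Submodule.span ℂ (Set.range v)) : y = ∑ k, ⟪u k, y⟫_ℂ • v k := by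
  obtain ⟨t, rfl⟩ := (Submodule.mem_span_range_iff_exists_fun ℂ).mp hy
  simp [huv]

theorem eq_sum_inner_smul_dual {v u : ι → H}
    (hu : ∀ i, u i ∈ Submodule.span ℂ (Set.range v))
    (huv : ∀ i j, ⟪u i, v j⟫_ℂ = if i = j then 1 else 0) {y : H}
    (hy : y ∈ Submodule.span ℂ (Set.range v)) : y = ∑ k, ⟪v k, y⟫_ℂ • u k := by
  rw [← sub_eq_zero]
  refine eq_zero_of_mem_span_of_inner_eq_zero (v := v) (Submodule.sub_mem _ hy
    (Submodule.sum_mem _ fun k _ => Submodule.smul_mem _ _ (hu k))) fun k => ?_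
  have hvu : ∀ i j, ⟪v j, u i⟫_ℂ = if i = j then 1 else 0 := fun i j => by
    rw [← inner_conj_symm, huv]; split_ifs <;> simp
  simp [hvu]

/-- The dual vectors are short if their Gram matrix is controlled by the matrix with diagonal
entries `1` and off-diagonal entries `- l i j`. -/
theorem norm_dual_le {v u : ι → H} (hv : ∀ i, ‖v i‖ = 1)
    (hu : ∀ i, u i ∈ Submodule.span ℂ (Set.range v))
    (huv : ∀ i j, ⟪u i, v j⟫_ℂ = if i = j then 1 else 0) {l : ι → ι → ℝ} {μ : ℝ}
    (hμ : ∀ c : ι → ℝ, μ * ∑ i, c i ^ 2 ≤ ∑ i, ∑ j, (if i = j then 1 else -l i j) * (c i * c j))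
    (hl : ∀ i j, i ≠ j → ‖⟪u i, u j⟫_ℂ‖ ≤ l i j * (‖u i‖ * ‖u j‖)) (i : ι) :
    μ * ‖u i‖ ^ 2 ≤ 1 := by
  by_cases hμ0 : μ ≤ 0
  · exact (mul_nonpos_of_nonpos_of_nonneg hμ0 (sq_nonneg _)).trans zero_le_one
  push Not at hμ0
  let a : ι → ℂ := fun k => ⟪v k, v i⟫_ℂ
  have hvi : v i = ∑ k, a k • u k :=
    eq_sum_inner_smul_dual hu huv (Submodule.subset_span ⟨i, rfl⟩)
  have hai : ‖a i‖ = 1 := by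
    simp only [a, inner_self_eq_norm_sq_to_K, hv]; simp
  -- The quadratic form is evaluated at the lengths `‖a k‖ * ‖u k‖` of the terms in the expansion of
  -- `v i`. The term of index `i` is `u i` itself, up to a phase.
  calc μ * ‖u i‖ ^ 2 = μ * (‖a i‖ * ‖u i‖) ^ 2 := by rw [hai, one_mul]
    _ ≤ μ * ∑ k, (‖a k‖ * ‖u k‖) ^ 2 := by
      gcongr
      exact Finset.single_le_sum (f := fun k => (‖a k‖ * ‖u k‖) ^ 2)
        (fun k _ => sq_nonneg _) (Finset.mem_univ i)
    _ ≤ _ := hμ _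
    _ ≤ ∑ k, ∑ j, (⟪a k • u k, a j • u j⟫_ℂ).re := by
      refine Finset.sum_le_sum fun k _ => Finset.sum_le_sum fun j _ => ?_
      split_ifs with hkj
      · subst hkj
        have h1 := inner_self_eq_norm_sq (𝕜 := ℂ) (a k • u k)
        rw [RCLike.re_eq_complex_re] at h1
        rw [h1, norm_smul, one_mul, sq]
      · have h1 : ‖⟪a k • u k, a j • u j⟫_ℂ‖ ≤ ‖a k‖ * ‖a j‖ * (l k j * (‖u k‖ * ‖u j‖)) := by
          rw [inner_smul_left, inner_smul_right, norm_mul, norm_mul, RCLike.norm_conj, ← mul_assoc]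
          gcongr
          exact hl k j hkj
        have h2 := (abs_le.mp (Complex.abs_re_le_norm (⟪a k • u k, a j • u j⟫_ℂ))).1
        nlinarith
    _ = (⟪v i, v i⟫_ℂ).re := by
      rw [hvi, sum_inner, Complex.re_sum]
      simp only [inner_sum, Complex.re_sum]
    _ = 1 := by
      rw [inner_self_eq_norm_sq_to_K, hv]; simp

/-- After projecting away `F`, only the indices `i` and `j` survive, so the claim reduces to a
plane: there the dual basis of two vectors makes the same angle as the vectors, or the supplementary
one. -/
theorem norm_inner_dual_le {v u : ι → H}
    (hu : ∀ i, u i ∈ Submodule.span ℂ (Set.range v))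
    (huv : ∀ i j, ⟪u i, v j⟫_ℂ = if i = j then 1 else 0)
    {F : Submodule ℂ H} [F.HasOrthogonalProjection] {i j : ι} (hij : i ≠ j)
    (hF : ∀ k, k ≠ i → k ≠ j → v k ∈ F)
    (hi : F.starProjection (v i) ∈ Submodule.span ℂ (v '' {i, j}ᶜ))
    (hj : F.starProjection (v j) ∈ Submodule.span ℂ (v '' {i, j}ᶜ)) {l : ℝ}
    (hl : ‖⟪v i - F.starProjection (v i), v j - F.starProjection (v j)⟫_ℂ‖ ≤
      l * (‖v i - F.starProjection (v i)‖ * ‖v j - F.starProjection (v j)‖)) :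
    ‖⟪u i, u j⟫_ℂ‖ ≤ l * (‖u i‖ * ‖u j‖) := by
  set P := F.starProjection with hP
  set wi := v i - P (v i) with hwi
  set wj := v j - P (v j) with hwj
  have hperp : ∀ a, (a = i ∨ a = j) → ∀ z ∈ Submodule.span ℂ (v '' {i, j}ᶜ), ⟪u a, z⟫_ℂ = 0 := by
    intro a ha z hz
    induction hz using Submodule.span_induction with
    | mem x hx =>
      obtain ⟨k, hk, rfl⟩ := hx
      rw [huv, if_neg]
      rintro rfl
      exact hk ha
    | zero => simp
    | add a b _ _ ha hb => rw [inner_add_right, ha, hb, add_zero]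
    | smul c a _ ha => rw [inner_smul_right, ha, mul_zero]
  have hPv : ∀ k, P (v k) ∈ Submodule.span ℂ (v '' {i, j}ᶜ) := by
    intro k
    by_cases h1 : k = i
    · exact h1 ▸ hi
    by_cases h2 : k = j
    · exact h2 ▸ hj
    rw [hP, Submodule.starProjection_eq_self_iff.mpr (hF k h1 h2)]
    exact Submodule.subset_span ⟨k, by simp [h1, h2], rfl⟩
  -- `P (u a)` lies in the span of the `v k` with `k ≠ i, j`, to which `u a` is orthogonal; hence it
  -- vanishes. Applying `1 - P` to the expansion of `u a` then kills all terms but two.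
  have hexp : ∀ a, (a = i ∨ a = j) → u a = ⟪u i, u a⟫_ℂ • wi + ⟪u j, u a⟫_ℂ • wj := by
    intro a ha
    have hPu : P (u a) ∈ Submodule.span ℂ (v '' {i, j}ᶜ) := by
      rw [eq_sum_inner_dual_smul huv (hu a), map_sum]
      refine Submodule.sum_mem _ fun k _ => ?_
      rw [map_smul]
      exact Submodule.smul_mem _ _ (hPv k)
    have hPu0 : P (u a) = 0 := by
      rw [← inner_self_eq_zero (𝕜 := ℂ)]
      have h2 : P (P (u a)) = P (u a) :=
        Submodule.starProjection_eq_self_iff.mpr (Submodule.starProjection_apply_mem _ _)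
      have h3 : ⟪P (u a), P (u a)⟫_ℂ = ⟪u a, P (P (u a))⟫_ℂ :=
        Submodule.inner_starProjection_left_eq_right _ _ _
      rw [h3, h2]
      exact hperp a ha _ hPu
    calc u a = u a - P (u a) := by rw [hPu0, sub_zero]
      _ = ∑ k, ⟪u k, u a⟫_ℂ • (v k - P (v k)) := by
        conv_lhs => rw [eq_sum_inner_dual_smul huv (hu a)]
        simp only [map_sum, map_smul, smul_sub, Finset.sum_sub_distrib]
      _ = _ := by
        rw [Finset.sum_eq_add_of_mem i j (Finset.mem_univ _) (Finset.mem_univ _) hij]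
        rintro k - ⟨h1, h2⟩
        rw [hP, Submodule.starProjection_eq_self_iff.mpr (hF k h1 h2), sub_self, smul_zero]
  have hdual : ∀ a b, (a = i ∨ a = j) → ⟪u a, v b - P (v b)⟫_ℂ = if a = b then 1 else 0 := by
    intro a b ha
    rw [inner_sub_right, hperp a ha _ (hPv b), sub_zero, huv]
  have hi0 : 0 < ‖wi‖ := by
    rw [norm_pos_iff]
    intro h0
    have := hdual i i (Or.inl rfl)
    rw [← hwi, h0] at this
    simp at this
  have hj0 : 0 < ‖wj‖ := by
    rw [norm_pos_iff]
    intro h0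
    have := hdual j j (Or.inr rfl)
    rw [← hwj, h0] at this
    simp at this
  -- Orthogonality of `u i` and `wj` relates the two off-diagonal inner products. The symmetric
  -- estimate is `key2`; in the product of both, the norms of `wi` and `wj` cancel.
  have key1 : ‖⟪u i, u j⟫_ℂ‖ * ‖wj‖ ≤ l * ‖u i‖ ^ 2 * ‖wi‖ := by
    have h1 : ⟪wj, u i⟫_ℂ = 0 := by
      rw [← inner_conj_symm, hdual i j (Or.inl rfl), if_neg hij, map_zero]
    rw [hexp i (Or.inl rfl), inner_add_right, inner_smul_right, inner_smul_right] at h1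
    have h2 : ‖⟪u j, u i⟫_ℂ * ⟪wj, wj⟫_ℂ‖ = ‖⟪u i, u i⟫_ℂ * ⟪wj, wi⟫_ℂ‖ := by
      rw [eq_neg_of_add_eq_zero_right h1, norm_neg]
    simp only [norm_mul, inner_self_eq_norm_sq_to_K, norm_pow, RCLike.norm_ofReal, abs_norm] at h2
    rw [norm_inner_symm (u j), norm_inner_symm wj] at h2
    have h3 : (‖⟪u i, u j⟫_ℂ‖ * ‖wj‖) * ‖wj‖ ≤ (l * ‖u i‖ ^ 2 * ‖wi‖) * ‖wj‖ := by
      calc _ = ‖u i‖ ^ 2 * ‖⟪wi, wj⟫_ℂ‖ := by rw [← h2]; ring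
        _ ≤ ‖u i‖ ^ 2 * (l * (‖wi‖ * ‖wj‖)) := by gcongr
        _ = _ := by ring
    exact le_of_mul_le_mul_right h3 hj0
  have key2 : ‖⟪u i, u j⟫_ℂ‖ * ‖wi‖ ≤ l * ‖u j‖ ^ 2 * ‖wj‖ := by
    have h1 : ⟪wi, u j⟫_ℂ = 0 := by
      rw [← inner_conj_symm, hdual j i (Or.inr rfl), if_neg hij.symm, map_zero]
    rw [hexp j (Or.inr rfl), inner_add_right, inner_smul_right, inner_smul_right] at h1
    have h2 : ‖⟪u i, u j⟫_ℂ * ⟪wi, wi⟫_ℂ‖ = ‖⟪u j, u j⟫_ℂ * ⟪wi, wj⟫_ℂ‖ := by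
      rw [eq_neg_of_add_eq_zero_left h1, norm_neg]
    simp only [norm_mul, inner_self_eq_norm_sq_to_K, norm_pow, RCLike.norm_ofReal, abs_norm] at h2
    have h3 : (‖⟪u i, u j⟫_ℂ‖ * ‖wi‖) * ‖wi‖ ≤ (l * ‖u j‖ ^ 2 * ‖wj‖) * ‖wi‖ := by
      calc _ = ‖u j‖ ^ 2 * ‖⟪wi, wj⟫_ℂ‖ := by rw [← h2]; ring
        _ ≤ ‖u j‖ ^ 2 * (l * (‖wi‖ * ‖wj‖)) := by gcongr
        _ = _ := by ring
    exact le_of_mul_le_mul_right h3 hi0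
  have hl0 : 0 ≤ l := by
    by_contra hc
    push Not at hc
    have h1 := (norm_nonneg _).trans hl
    have h2 := mul_neg_of_neg_of_pos hc (mul_pos hi0 hj0)
    linarith
  have hmul := mul_le_mul key1 key2 (by positivity) (by positivity)
  have hsq : ‖⟪u i, u j⟫_ℂ‖ ^ 2 ≤ (l * (‖u i‖ * ‖u j‖)) ^ 2 := by
    have hp : 0 < ‖wi‖ * ‖wj‖ := mul_pos hi0 hj0
    refine le_of_mul_le_mul_right ?_ hp
    calc _ = ‖⟪u i, u j⟫_ℂ‖ * ‖wj‖ * (‖⟪u i, u j⟫_ℂ‖ * ‖wi‖) := by ring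
      _ ≤ _ := hmul
      _ = _ := by ring
  exact (abs_le_of_sq_le_sq' hsq (by positivity)).2

end DualBasis

/-! ### Quadratic forms and extreme eigenvalues. -/

section Rayleigh

/-- A symmetric operator is bounded above by any upper bound of its eigenvalues. -/
theorem inner_apply_self_le {E : Type*} [NormedAddCommGroup E] [InnerProductSpace ℝ E]
    [FiniteDimensional ℝ E] {T : E →ₗ[ℝ] E} (hT : T.IsSymmetric) {c : ℝ}
    (h : ∀ t, Module.End.HasEigenvalue T t → t ≤ c) (y : E) :
    inner ℝ (T y) y ≤ c * ‖y‖ ^ 2 := by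
  let b := hT.eigenvectorBasis rfl
  rw [← real_inner_self_eq_norm_sq y, ← b.sum_inner_mul_inner (T y) y, ← b.sum_inner_mul_inner y y,
    Finset.mul_sum]
  refine Finset.sum_le_sum fun k _ => ?_
  have h1 : inner ℝ (T y) (b k) = hT.eigenvalues rfl k * inner ℝ y (b k) := by
    rw [hT y (b k), hT.apply_eigenvectorBasis, inner_smul_right]
    rfl
  rw [h1, real_inner_comm y (b k), mul_assoc]
  exact mul_le_mul_of_nonneg_right (h _ (hT.hasEigenvalue_eigenvalues rfl k)) (mul_self_nonneg _)

theorem iInf_eigenvalues_mul_le {ι : Type*} [Fintype ι] [DecidableEq ι] {A : Matrix ι ι ℝ}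
    (hA : A.IsHermitian) (c : ι → ℝ) :
    (⨅ i, hA.eigenvalues i) * ∑ i, c i ^ 2 ≤ ∑ i, ∑ j, A i j * (c i * c j) := by
  set μ := ⨅ i, hA.eigenvalues i
  have hsymm := Matrix.isSymmetric_toEuclideanLin_iff.mpr hA
  -- The sign change turns the upper bound for a symmetric operator into a lower bound.
  have h1 := inner_apply_self_le (T := -A.toEuclideanLin) (c := -μ) (by
    intro x y
    simp only [LinearMap.neg_apply, inner_neg_left, inner_neg_right]
    rw [hsymm x y]) (by
    intro t ht
    obtain ⟨z, hz, hz0⟩ := ht.exists_hasEigenvector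
    rw [Module.End.mem_eigenspace_iff] at hz
    have hmem : -t ∈ spectrum ℝ A := by
      rw [← Matrix.spectrum_toLpLin 2]
      refine Module.End.HasEigenvalue.mem_spectrum
        (Module.End.hasEigenvalue_of_hasEigenvector (x := z) ⟨?_, hz0⟩)
      rw [Module.End.mem_eigenspace_iff, neg_smul, ← hz]
      simp
    rw [hA.spectrum_real_eq_range_eigenvalues] at hmem
    obtain ⟨i, hi⟩ := hmem
    have : μ ≤ hA.eigenvalues i := ciInf_le (Set.finite_range _).bddBelow i
    linarith) (WithLp.toLp 2 c)
  simp only [LinearMap.neg_apply, inner_neg_left, EuclideanSpace.real_norm_sq_eq] at h1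
  have h2 : inner ℝ (A.toEuclideanLin (WithLp.toLp 2 c)) (WithLp.toLp 2 c) =
      ∑ i, ∑ j, A i j * (c i * c j) := by
    simp only [PiLp.inner_apply, Matrix.toLpLin_toLp]
    refine Finset.sum_congr rfl fun i _ => ?_
    simp only [Matrix.toLin'_apply, Matrix.mulVec, dotProduct, RCLike.inner_apply, conj_trivial,
      Finset.mul_sum]
    refine Finset.sum_congr rfl fun j _ => ?_
    ring
  rw [h2] at h1
  linarith

end Rayleigh

/-! ### The spectral gap of the random walk on a finite graph. -/

section RandomWalk

open Finset

variable {W : Type*} (Γ : SimpleGraph W) [DecidableRel Γ.Adj]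

theorem adjMatrix_nonneg (v u : W) : 0 ≤ Γ.adjMatrix ℝ v u := by
  rw [SimpleGraph.adjMatrix_apply]
  split_ifs <;> norm_num

theorem adjMatrix_comm (v u : W) : Γ.adjMatrix ℝ v u = Γ.adjMatrix ℝ u v := by
  simp only [SimpleGraph.adjMatrix_apply, Γ.adj_comm]

variable [Fintype W]

theorem randomWalk_apply (φ : W → ℝ) (v : W) :
    randomWalk Γ φ v = (∑ u, Γ.adjMatrix ℝ v u * φ u) / ∑ u, Γ.adjMatrix ℝ v u := by
  have h1 : ∑ᶠ u ∈ Γ.neighborSet v, φ u = ∑ u, Γ.adjMatrix ℝ v u * φ u := by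
    rw [finsum_mem_eq_finite_toFinset_sum _ (Set.toFinite _)]
    simp only [SimpleGraph.adjMatrix_apply, ite_mul, one_mul, zero_mul, ← Finset.sum_filter]
    exact sum_congr (by ext; simp) fun _ _ => rfl
  have h2 : ((Γ.neighborSet v).ncard : ℝ) = ∑ u, Γ.adjMatrix ℝ v u := by
    simp [Set.ncard_eq_toFinset_card', SimpleGraph.adjMatrix_apply]
  rw [randomWalk, h1, h2]

variable {Γ}

/-- The eigenvalues of the random walk are at most `1`. -/
theorem le_one_of_randomWalk_eq {φ : W → ℝ} (hφ : φ ≠ 0) {t : ℝ}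
    (h : randomWalk Γ φ = t • φ) : t ≤ 1 := by
  obtain ⟨w, hw⟩ := Function.ne_iff.mp hφ
  obtain ⟨v, -, hv⟩ := exists_max_image univ (fun v => |φ v|) ⟨w, mem_univ w⟩
  have hpos : 0 < |φ v| := (abs_pos.mpr hw).trans_le (hv w (mem_univ w))
  have h1 := congrFun h v
  rw [randomWalk_apply, Pi.smul_apply, smul_eq_mul] at h1
  have h2 : |t| * |φ v| ≤ 1 * |φ v| := by
    have hd : 0 ≤ ∑ u, Γ.adjMatrix ℝ v u := sum_nonneg fun u _ => adjMatrix_nonneg Γ v u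
    rw [← abs_mul, ← h1, abs_div, one_mul, abs_of_nonneg hd]
    refine div_le_of_le_mul₀ hd hpos.le ?_
    refine (abs_sum_le_sum_abs _ _).trans ?_
    rw [mul_sum]
    refine sum_le_sum fun u _ => ?_
    rw [abs_mul, abs_of_nonneg (adjMatrix_nonneg Γ v u), mul_comm]
    exact mul_le_mul_of_nonneg_right (hv u (mem_univ u)) (adjMatrix_nonneg Γ v u)
  exact (le_abs_self t).trans (le_of_mul_le_mul_right h2 hpos)

/-- An eigenvalue of the random walk with an eigenfunction orthogonal to the constants is at most
the second largest eigenvalue. -/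
theorem le_secondEigenvalue (hdeg : ∀ v, 0 < ∑ u, Γ.adjMatrix ℝ v u) {φ : W → ℝ} (hφ : φ ≠ 0)
    (h0 : ∑ v, (∑ u, Γ.adjMatrix ℝ v u) * φ v = 0) {t : ℝ} (h : randomWalk Γ φ = t • φ) :
    t ≤ secondEigenvalue Γ := by
  -- The second eigenfunction is the constant `1`, with eigenvalue `1`. It is independent of `φ`
  -- because `φ` has degree-weighted mean zero.
  refine le_csSup ⟨1, ?_⟩ ⟨1, le_one_of_randomWalk_eq hφ h, φ, 1, ?_, h, ?_⟩
  · rintro r ⟨s, hrs, f, g, hfg, -, hg⟩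
    exact hrs.trans (le_one_of_randomWalk_eq (hfg.ne_zero 1) hg)
  · obtain ⟨w, hw⟩ := Function.ne_iff.mp hφ
    rw [LinearIndependent.pair_iff]
    intro a b hab
    have h1 : ∀ v, a * φ v + b = 0 := fun v => by simpa using congrFun hab v
    have h2 : b * ∑ v, ∑ u, Γ.adjMatrix ℝ v u = 0 := by
      have : ∑ v, (∑ u, Γ.adjMatrix ℝ v u) * (a * φ v + b) = 0 :=
        sum_eq_zero fun v _ => by rw [h1, mul_zero]
      calc _ = a * ∑ v, (∑ u, Γ.adjMatrix ℝ v u) * φ v + b * ∑ v, ∑ u, Γ.adjMatrix ℝ v u := by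
            rw [h0, mul_zero, zero_add]
        _ = ∑ v, (∑ u, Γ.adjMatrix ℝ v u) * (a * φ v + b) := by
            rw [mul_sum, mul_sum, ← sum_add_distrib]
            exact sum_congr rfl fun v _ => by ring
        _ = 0 := this
    have hb : b = 0 := (mul_eq_zero.mp h2).resolve_right
      (sum_pos (fun v _ => hdeg v) ⟨w, mem_univ w⟩).ne'
    refine ⟨?_, hb⟩
    have h3 := h1 w
    rw [hb, add_zero] at h3
    exact (mul_eq_zero.mp h3).resolve_right hw
  · funext v
    rw [randomWalk_apply]
    simp only [Pi.one_apply, mul_one, one_smul]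
    exact div_self (hdeg v).ne'

/-- Conjugating by the square roots of the degrees makes the random walk symmetric and turns the
constants into the eigenvector `σ`. On the orthogonal complement of `σ`, every eigenvalue is bounded
by `le_secondEigenvalue`. -/
theorem sum_adjMatrix_mul_mul_le (hdeg : ∀ v, 0 < ∑ u, Γ.adjMatrix ℝ v u) {φ : W → ℝ}
    (h0 : ∑ v, (∑ u, Γ.adjMatrix ℝ v u) * φ v = 0) :
    ∑ v, ∑ u, Γ.adjMatrix ℝ v u * (φ v * φ u) ≤
      secondEigenvalue Γ * ∑ v, (∑ u, Γ.adjMatrix ℝ v u) * φ v ^ 2 := by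
  classical
  let d : W → ℝ := fun v => ∑ u, Γ.adjMatrix ℝ v u
  let s : W → ℝ := fun v => √(d v)
  have hs : ∀ v, 0 < s v := fun v => Real.sqrt_pos.mpr (hdeg v)
  have hss : ∀ v, s v * s v = d v := fun v => Real.mul_self_sqrt (hdeg v).le
  let B : Matrix W W ℝ := Matrix.of fun v u => Γ.adjMatrix ℝ v u / (s v * s u)
  have hB : B.IsHermitian := by
    ext v u
    simp only [B, Matrix.conjTranspose_apply, Matrix.of_apply, star_trivial, adjMatrix_comm Γ u v,
      mul_comm]
  let T := B.toEuclideanLin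
  have hT : T.IsSymmetric := Matrix.isSymmetric_toEuclideanLin_iff.mpr hB
  have hTa : ∀ (g : EuclideanSpace ℝ W) v,
      T g v = (∑ u, Γ.adjMatrix ℝ v u * (g u / s u)) / s v := by
    intro g v
    simp only [T, B, Matrix.toLpLin_apply, Matrix.mulVec, dotProduct, Matrix.of_apply, sum_div]
    refine sum_congr rfl fun u _ => ?_
    have := (hs v).ne'
    have := (hs u).ne'
    field_simp
  let σ : EuclideanSpace ℝ W := WithLp.toLp 2 s
  have hTσ : T σ = σ := by
    ext v
    rw [hTa]
    have : ∀ u, Γ.adjMatrix ℝ v u * (σ u / s u) = Γ.adjMatrix ℝ v u := fun u => by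
      rw [show σ u = s u from rfl, div_self (hs u).ne', mul_one]
    simp only [this]
    exact (div_eq_iff (hs v).ne').mpr (hss v).symm
  let V := (Submodule.span ℝ {σ})ᗮ
  have hV : ∀ g, g ∈ V ↔ ∑ v, s v * g v = 0 := by
    intro g
    rw [Submodule.mem_orthogonal_singleton_iff_inner_right, PiLp.inner_apply]
    simp [σ, mul_comm]
  have hVT : ∀ g ∈ V, T g ∈ V := by
    intro g hg
    rw [Submodule.mem_orthogonal_singleton_iff_inner_right] at hg ⊢
    rw [← hT, hTσ, hg]
  let y : EuclideanSpace ℝ W := WithLp.toLp 2 fun v => s v * φ v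
  have hy : y ∈ V := by
    rw [hV, ← h0]
    refine sum_congr rfl fun v _ => ?_
    simp only [y, ← mul_assoc, hss, d]
  have key := inner_apply_self_le (hT.restrict_invariant hVT) (c := secondEigenvalue Γ) (by
    intro t ht
    obtain ⟨g, hg, hg0⟩ := ht.exists_hasEigenvector
    rw [Module.End.mem_eigenspace_iff] at hg
    have hg' : T g = t • (g : EuclideanSpace ℝ W) := congrArg Subtype.val hg
    refine le_secondEigenvalue hdeg (φ := fun v => g.1 v / s v) ?_ ?_ ?_
    · intro h
      apply hg0
      ext v
      have := congrFun h v
      simpa [(hs v).ne'] using this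
    · rw [← (hV g).mp g.2]
      refine sum_congr rfl fun v _ => ?_
      change d v * _ = _
      rw [← hss]
      field_simp [(hs v).ne']
    · funext v
      have h1 := congrArg (fun f : EuclideanSpace ℝ W => f v) hg'
      simp only [hTa, PiLp.smul_apply, smul_eq_mul] at h1
      rw [randomWalk_apply, Pi.smul_apply, smul_eq_mul]
      change _ / d v = _
      rw [← hss, ← div_div, h1, mul_div_assoc]) ⟨y, hy⟩
  have h1 : inner ℝ ((T.restrict hVT) ⟨y, hy⟩) (⟨y, hy⟩ : V) =
      ∑ v, ∑ u, Γ.adjMatrix ℝ v u * (φ v * φ u) := by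
    rw [Submodule.coe_inner, LinearMap.coe_restrict_apply, PiLp.inner_apply]
    refine sum_congr rfl fun v _ => ?_
    rw [hTa]
    simp only [y, RCLike.inner_apply, conj_trivial]
    rw [mul_div_assoc', div_eq_iff (hs v).ne', mul_sum, sum_mul]
    refine sum_congr rfl fun u _ => ?_
    have := (hs u).ne'
    field_simp
  have h2 : ‖(⟨y, hy⟩ : V)‖ ^ 2 = ∑ v, (∑ u, Γ.adjMatrix ℝ v u) * φ v ^ 2 := by
    rw [Submodule.coe_norm, EuclideanSpace.real_norm_sq_eq]
    refine sum_congr rfl fun v _ => ?_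
    change (s v * φ v) ^ 2 = d v * _
    rw [← hss]
    ring
  rwa [h1, h2] at key

/-- The spectral gap inequality for functions with values in a Euclidean space. -/
theorem sum_adjMatrix_mul_inner_le {E : Type*} [NormedAddCommGroup E] [InnerProductSpace ℝ E]
    (hdeg : ∀ v, 0 < ∑ u, Γ.adjMatrix ℝ v u) {Φ : W → E}
    (h0 : ∑ v, (∑ u, Γ.adjMatrix ℝ v u) • Φ v = 0) :
    ∑ v, ∑ u, Γ.adjMatrix ℝ v u * inner ℝ (Φ v) (Φ u) ≤
      secondEigenvalue Γ * ∑ v, (∑ u, Γ.adjMatrix ℝ v u) * ‖Φ v‖ ^ 2 := by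
  let F := Submodule.span ℝ (Set.range Φ)
  have : FiniteDimensional ℝ F := FiniteDimensional.span_of_finite ℝ (Set.finite_range Φ)
  let Ψ : W → F := fun v => ⟨Φ v, Submodule.subset_span ⟨v, rfl⟩⟩
  -- The scalar inequality is applied to each coordinate and summed.
  let b := stdOrthonormalBasis ℝ F
  have hinner : ∀ v u, inner ℝ (Φ v) (Φ u) = ∑ k, inner ℝ (b k) (Ψ v) * inner ℝ (b k) (Ψ u) := by
    intro v u
    rw [show inner ℝ (Φ v) (Φ u) = inner ℝ (Ψ v) (Ψ u) from rfl, ← b.sum_inner_mul_inner]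
    exact sum_congr rfl fun k _ => by rw [real_inner_comm]
  have hnorm : ∀ v, ‖Φ v‖ ^ 2 = ∑ k, inner ℝ (b k) (Ψ v) ^ 2 := by
    intro v
    rw [← real_inner_self_eq_norm_sq, hinner]
    exact sum_congr rfl fun k _ => (sq _).symm
  have h0' : ∑ v, (∑ u, Γ.adjMatrix ℝ v u) • Ψ v = 0 := by
    apply Subtype.ext
    rw [Submodule.coe_sum]
    exact h0
  calc _ = ∑ k, ∑ v, ∑ u, Γ.adjMatrix ℝ v u * (inner ℝ (b k) (Ψ v) * inner ℝ (b k) (Ψ u)) := by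
        simp only [hinner, mul_sum]
        exact (sum_comm.trans (sum_congr rfl fun v _ => sum_comm)).symm
    _ ≤ ∑ k, secondEigenvalue Γ * ∑ v, (∑ u, Γ.adjMatrix ℝ v u) * inner ℝ (b k) (Ψ v) ^ 2 := by
        refine sum_le_sum fun k _ => sum_adjMatrix_mul_mul_le hdeg ?_
        have h1 := congrArg (fun f => inner ℝ (b k) f) h0'
        simpa only [inner_sum, inner_smul_right, inner_zero_right] using h1
    _ = _ := by
        rw [← mul_sum, sum_comm]
        simp only [hnorm, mul_sum]

end RandomWalk

/-! ### Chambers, their faces and stabilizers. -/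

section Chambers

variable {V : Type*} [DecidableEq V] {n : ℕ} {G : Type*} [Group G] [MulAction G V]
  {X : AbstractSimplicialComplex V} {S : Fin (n + 1) → Set V} {x : Fin (n + 1) → V}

theorem smul_mem_side (h : IsBPair G X S) (g : G) {v : V} {k : Fin (n + 1)} (hv : v ∈ S k)
    (hX : {v} ∈ X.faces) : g • v ∈ S k := by
  have h1 := h.type_smul g {v} hX
  have h2 : k ∈ faceType S {v} := ⟨v, Finset.mem_singleton_self v, hv⟩
  rw [← h1] at h2
  obtain ⟨w, hw, hwk⟩ := h2
  rw [Finset.smul_finset_singleton, Finset.mem_singleton] at hw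
  exact hw ▸ hwk

theorem IsChamber.singleton_mem (hx : IsChamber X S x) (k : Fin (n + 1)) : {x k} ∈ X.faces :=
  (X.isRelLowerSet_faces hx.1).2
    (Finset.singleton_subset_iff.mpr (Finset.mem_image_of_mem x (Finset.mem_univ k)))
    (Finset.singleton_nonempty _)

theorem IsChamber.smul_mem_side (h : IsBPair G X S) (hx : IsChamber X S x) (g : G)
    (k : Fin (n + 1)) : g • x k ∈ S k :=
  PartiteComplex.smul_mem_side h g (hx.2 k) (hx.singleton_mem k)

theorem IsChamber.injective (h : IsBPair G X S) (hx : IsChamber X S x) : Function.Injective x := by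
  intro i j hij
  by_contra hne
  exact Set.disjoint_left.mp (h.partite.1 hne) (hx.2 i) (hij ▸ hx.2 j)

theorem IsChamber.card_image (h : IsBPair G X S) (hx : IsChamber X S x) :
    (Finset.univ.image x).card = n + 1 := by
  rw [Finset.card_image_of_injective _ (hx.injective h)]
  simp

theorem eq_of_mem_side (h : IsBPair G X S) {v w : V} {i j : Fin (n + 1)} (hi : v ∈ S i)
    (hj : w ∈ S j) (hvw : v = w) : i = j := by
  by_contra hne
  exact Set.disjoint_left.mp (h.partite.1 hne) hi (hvw ▸ hj)

/-- An element of the group fixes a vertex of a chamber whose image belongs to the chamber. -/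
theorem IsChamber.smul_eq_of_mem (h : IsBPair G X S) (hx : IsChamber X S x) {g : G}
    {k : Fin (n + 1)} (hg : x k ∈ g • Finset.univ.image x) : g • x k = x k := by
  obtain ⟨y, hy, hyk⟩ := Finset.mem_smul_finset.mp hg
  obtain ⟨l, -, rfl⟩ := Finset.mem_image.mp hy
  have : l = k := eq_of_mem_side h (hx.smul_mem_side h g l) (hx.2 k) hyk
  rw [← this] at hyk ⊢
  exact hyk

theorem mem_oppositeFace_iff (hx : Function.Injective x) {i j k : Fin (n + 1)} :
    x k ∈ oppositeFace x i j ↔ k ≠ i ∧ k ≠ j := by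
  rw [oppositeFace, hx.mem_finset_image]
  simp

theorem oppositeFace_subset (i j : Fin (n + 1)) : oppositeFace x i j ⊆ Finset.univ.image x :=
  Finset.image_subset_image (Finset.subset_univ _)

/-- The stabilizer of a face of a chamber fixes its vertices. -/
theorem IsChamber.smul_eq_of_mem_stabilizer (h : IsBPair G X S) (hx : IsChamber X S x) {g : G}
    {i j k : Fin (n + 1)} (hg : g ∈ MulAction.stabilizer G (oppositeFace x i j))
    (hi : k ≠ i) (hj : k ≠ j) : g • x k = x k := by
  refine hx.smul_eq_of_mem h ?_
  have h1 : x k ∈ oppositeFace x i j := (mem_oppositeFace_iff (hx.injective h)).mpr ⟨hi, hj⟩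
  rw [← MulAction.mem_stabilizer_iff.mp hg] at h1
  exact Finset.smul_finset_subset_smul_finset (oppositeFace_subset i j) h1

theorem smul_oppositeFace_eq {g : G} {i j : Fin (n + 1)}
    (hg : ∀ k, k ≠ i → k ≠ j → g • x k = x k) :
    g ∈ MulAction.stabilizer G (oppositeFace x i j) := by
  rw [MulAction.mem_stabilizer_iff]
  unfold oppositeFace
  rw [Finset.smul_finset_def, Finset.image_image]
  refine Finset.image_congr fun k hk => ?_
  simp only [Finset.coe_compl, Finset.coe_insert, Finset.coe_singleton, Set.mem_compl_iff,
    Set.mem_insert_iff, Set.mem_singleton_iff, not_or] at hk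
  exact hg k hk.1 hk.2

theorem oppositeFace_mem (hn : 2 ≤ n) (hx : IsChamber X S x) (i j : Fin (n + 1)) :
    oppositeFace x i j ∈ X.faces := by
  refine (X.isRelLowerSet_faces hx.1).2 (oppositeFace_subset i j) ?_
  refine Finset.Nonempty.image ?_ x
  rw [← Finset.card_pos, Finset.card_compl, Fintype.card_fin]
  have := Finset.card_le_two (a := i) (b := j)
  omega

theorem card_oppositeFace (h : IsBPair G X S) (hx : IsChamber X S x) {i j : Fin (n + 1)}
    (hn : 2 ≤ n) (hij : i ≠ j) : (oppositeFace x i j).card + 1 = n := by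
  rw [oppositeFace, Finset.card_image_of_injective _ (hx.injective h), Finset.card_compl,
    Fintype.card_fin, Finset.card_pair hij]
  omega

theorem faceType_oppositeFace (h : IsBPair G X S) (hx : IsChamber X S x) (i j : Fin (n + 1)) :
    faceType S (oppositeFace x i j) = {i, j}ᶜ := by
  ext k
  constructor
  · rintro ⟨v, hv, hvk⟩
    obtain ⟨l, hl, rfl⟩ := Finset.mem_image.mp hv
    have : k = l := eq_of_mem_side h hvk (hx.2 l) rfl
    subst this
    simpa using hl
  · intro hk
    refine ⟨x k, Finset.mem_image_of_mem x ?_, hx.2 k⟩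
    simpa using hk

/-- A chamber that contains a face of the chamber `x` is the image of `x` under an element of the
stabilizer of this face. -/
theorem IsChamber.exists_stabilizer_smul_eq (h : IsBPair G X S) (hx : IsChamber X S x)
    {i j : Fin (n + 1)} {σ : Finset V} (hσ : σ ∈ X.faces) (hc : σ.card = n + 1)
    (hs : oppositeFace x i j ⊆ σ) :
    ∃ g ∈ MulAction.stabilizer G (oppositeFace x i j), g • Finset.univ.image x = σ := by
  obtain ⟨g, rfl⟩ := h.transitive _ hx.1 σ hσ (hx.card_image h) hc
  refine ⟨g, smul_oppositeFace_eq fun k hi hj => hx.smul_eq_of_mem h (hs ?_), rfl⟩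
  exact (mem_oppositeFace_iff (hx.injective h)).mpr ⟨hi, hj⟩

end Chambers

/-! ### The link of a face of codimension two. -/

section Link

variable {V : Type*} [DecidableEq V] {n : ℕ} {G : Type*} [Group G] [MulAction G V]
  {X : AbstractSimplicialComplex V} {S : Fin (n + 1) → Set V} {x : Fin (n + 1) → V}

theorem eq_or_eq_of_mem_smul (h : IsBPair G X S) (hx : IsChamber X S x) {i j : Fin (n + 1)} {g : G}
    (hg : g ∈ MulAction.stabilizer G (oppositeFace x i j)) {v : V}
    (hv : v ∈ g • Finset.univ.image x) (hd : v ∉ oppositeFace x i j) :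
    v = g • x i ∨ v = g • x j := by
  obtain ⟨y, hy, rfl⟩ := Finset.mem_smul_finset.mp hv
  obtain ⟨k, -, rfl⟩ := Finset.mem_image.mp hy
  by_cases hi : k = i
  · exact Or.inl (by rw [hi])
  by_cases hj : k = j
  · exact Or.inr (by rw [hj])
  rw [hx.smul_eq_of_mem_stabilizer h hg hi hj, mem_oppositeFace_iff (hx.injective h)] at hd
  exact absurd ⟨hi, hj⟩ hd

/-- The stabilizer of `τ` acts transitively on the edges of the link of `τ`. -/
theorem exists_smul_eq_of_adj (h : IsBPair G X S) (hn : 2 ≤ n) (hx : IsChamber X S x)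
    {i j : Fin (n + 1)} (hij : i ≠ j)
    {v w : {v : V // {v} ∈ (link X (oppositeFace x i j)).faces}}
    (hvw : (skeletonGraph (link X (oppositeFace x i j))).Adj v w) :
    ∃ g ∈ MulAction.stabilizer G (oppositeFace x i j),
      (v.1 = g • x i ∧ w.1 = g • x j) ∨ (v.1 = g • x j ∧ w.1 = g • x i) := by
  obtain ⟨hne, -, hd, hX⟩ := hvw
  have hne' : v.1 ≠ w.1 := fun h => hne (Subtype.ext h)
  obtain ⟨g, hg, hgx⟩ := hx.exists_stabilizer_smul_eq h hX (by
    rw [Finset.card_union_of_disjoint hd, Finset.card_pair hne']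
    have := card_oppositeFace h hx hn hij
    omega) Finset.subset_union_right
  have hv := eq_or_eq_of_mem_smul h hx hg (v := v.1) (by rw [hgx]; simp)
    (Finset.disjoint_left.mp hd (by simp))
  have hw := eq_or_eq_of_mem_smul h hx hg (v := w.1) (by rw [hgx]; simp)
    (Finset.disjoint_left.mp hd (by simp))
  refine ⟨g, hg, ?_⟩
  rcases hv with hv | hv <;> rcases hw with hw | hw
  · exact absurd (hv.trans hw.symm) hne'
  · exact Or.inl ⟨hv, hw⟩
  · exact Or.inr ⟨hv, hw⟩
  · exact absurd (hv.trans hw.symm) hne'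

theorem smul_pair_mem_link (h : IsBPair G X S) (hx : IsChamber X S x) {i j : Fin (n + 1)}
    {g : G} (hg : g ∈ MulAction.stabilizer G (oppositeFace x i j)) :
    {g • x i, g • x j} ∈ (link X (oppositeFace x i j)).faces := by
  have h1 : ({x i, x j} : Finset V) ∈ (link X (oppositeFace x i j)).faces := by
    refine ⟨by simp, ?_, ?_⟩
    · rw [Finset.disjoint_left]
      intro v hv
      rcases Finset.mem_insert.mp hv with rfl | hv
      · simp [mem_oppositeFace_iff (hx.injective h)]
      · rw [Finset.mem_singleton.mp hv]
        simp [mem_oppositeFace_iff (hx.injective h)]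
    · refine (X.isRelLowerSet_faces hx.1).2 (Finset.union_subset ?_ (oppositeFace_subset i j))
        (by simp)
      intro v hv
      rcases Finset.mem_insert.mp hv with rfl | hv
      · simp
      · rw [Finset.mem_singleton.mp hv]; simp
  have h2 := mem_link_smul h g _ _ h1
  rwa [MulAction.mem_stabilizer_iff.mp hg, Finset.smul_finset_insert,
    Finset.smul_finset_singleton] at h2

/-- By purity the vertex lies in a chamber containing the face; the other vertex of that chamber
outside the face is a neighbour. This gives positive degrees in the spectral estimate. -/
theorem exists_adj_link (h : IsBPair G X S) (hx : IsChamber X S x)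
    {i j : Fin (n + 1)} (hij : i ≠ j)
    (v : {v : V // {v} ∈ (link X (oppositeFace x i j)).faces}) :
    ∃ w, (skeletonGraph (link X (oppositeFace x i j))).Adj v w := by
  obtain ⟨-, hd, hX⟩ := v.2
  obtain ⟨σ, hσ, hc, hs⟩ := h.pure.2 _ hX
  obtain ⟨g, hg, rfl⟩ := hx.exists_stabilizer_smul_eq h hσ hc
    (Finset.subset_union_right.trans hs)
  have hp := smul_pair_mem_link h hx hg
  have hne : g • x i ≠ g • x j := fun e => hij (hx.injective h (MulAction.injective g e))
  have hsub : ∀ y ∈ ({g • x i, g • x j} : Finset V),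
      {y} ∈ (link X (oppositeFace x i j)).faces := fun y hy =>
    ((link X (oppositeFace x i j)).isRelLowerSet_faces hp).2
      (Finset.singleton_subset_iff.mpr hy) (Finset.singleton_nonempty y)
  rcases eq_or_eq_of_mem_smul h hx hg (v := v.1) (hs (by simp)) (by simpa using hd) with hv | hv
  · refine ⟨⟨g • x j, hsub _ (by simp)⟩, fun e => hne ?_, ?_⟩
    · rw [← hv, e]
    · rw [hv]; exact hp
  · refine ⟨⟨g • x i, hsub _ (by simp)⟩, fun e => hne ?_, ?_⟩
    · rw [← hv, e]
    · rw [hv, Finset.pair_comm]; exact hp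

/-- The automorphism of the link of `τ` induced by an element of the stabilizer of `τ`. -/
def linkAut (h : IsBPair G X S) {τ : Finset V} {g : G} (hg : g ∈ MulAction.stabilizer G τ) :
    skeletonGraph (link X τ) ≃g skeletonGraph (link X τ) where
  toFun v := ⟨g • v.1, by
    have := mem_link_smul h g τ _ v.2
    rwa [MulAction.mem_stabilizer_iff.mp hg, Finset.smul_finset_singleton] at this⟩
  invFun v := ⟨g⁻¹ • v.1, by
    have := mem_link_smul h g⁻¹ τ _ v.2
    rwa [MulAction.mem_stabilizer_iff.mp (inv_mem hg), Finset.smul_finset_singleton] at this⟩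
  left_inv v := by simp
  right_inv v := by simp
  map_rel_iff' := by
    intro a b
    have key : ∀ g ∈ MulAction.stabilizer G τ, ∀ a b : V, {a, b} ∈ (link X τ).faces →
        {g • a, g • b} ∈ (link X τ).faces := by
      intro g hg a b hab
      have := mem_link_smul h g τ _ hab
      rwa [MulAction.mem_stabilizer_iff.mp hg, Finset.smul_finset_insert,
        Finset.smul_finset_singleton] at this
    simp only [skeletonGraph, Equiv.coe_fn_mk, ne_eq, Subtype.ext_iff]
    refine and_congr (by simp) ⟨fun H => ?_, key g hg _ _⟩
    simpa using key g⁻¹ (inv_mem hg) _ _ H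

end Link

/-! ### Generation by panel stabilizers, and linear independence. -/

section Generation

variable {V : Type*} [DecidableEq V] {n : ℕ} {G : Type*} [Group G] [MulAction G V]
  {X : AbstractSimplicialComplex V} {S : Fin (n + 1) → Set V} {x : Fin (n + 1) → V}
  {H : Type*} [NormedAddCommGroup H] [InnerProductSpace ℂ H]

/-- A vector fixed by the stabilizers of the panels of a chamber is invariant. -/
theorem invariant_of_fixed_panels (h : IsBPair G X S) (hn : 2 ≤ n) (hx : IsChamber X S x)
    (π : G →* (H ≃ₗᵢ[ℂ] H)) {v : H}
    (hv : ∀ (l : Fin (n + 1)) (g : G), (∀ k, k ≠ l → g • x k = x k) → π g v = v) (g : G) :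
    π g v = v := by
  have hfaces : ∀ σ, σ ∈ (link X ∅).faces ↔ σ ∈ X.faces := fun σ =>
    ⟨fun hs => by simpa using hs.2.2, fun hs => ⟨(X.isRelLowerSet_faces hs).1, by simp, by simpa⟩⟩
  have hgx : g • Finset.univ.image x ∈ X.faces := h.smul_mem g _ hx.1
  have hgc : (g • Finset.univ.image x).card = n + 1 := by
    rw [Finset.card_smul_finset, hx.card_image h]
  have hgal := h.gallery_links ∅ (Or.inl rfl) n (by omega) (by simp) _ ((hfaces _).mpr hx.1) _
    ((hfaces _).mpr hgx) (hx.card_image h) hgc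
  suffices ∀ σ, Relation.ReflTransGen (fun a b : Finset V => (a ∈ (link X ∅).faces ∧
      a.card = n + 1) ∧ (b ∈ (link X ∅).faces ∧ b.card = n + 1) ∧ (a ∩ b).card = n)
      (Finset.univ.image x) σ → ∀ g : G, g • Finset.univ.image x = σ → π g v = v from
    this _ hgal g rfl
  intro σ hσ
  induction hσ with
  | refl =>
    intro g hg
    -- Here `g` fixes every vertex of the chamber, so any panel would do.
    refine hv 0 g fun k _ => hx.smul_eq_of_mem h ?_
    rw [hg]
    simp
  | tail _ hbc ih =>
    intro g' hg'
    obtain ⟨⟨hb, hbc'⟩, -, hint⟩ := hbc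
    obtain ⟨g, rfl⟩ := h.transitive _ hx.1 _ ((hfaces _).mp hb) (hx.card_image h) hbc'
    subst hg'
    have hcard : (Finset.univ.image x ∩ (g⁻¹ * g') • Finset.univ.image x).card = n := by
      refine Eq.trans ?_ hint
      rw [← Finset.card_smul_finset g (Finset.univ.image x ∩ _), Finset.smul_finset_inter,
        smul_smul, mul_inv_cancel_left]
    -- Pulled back by `g`, the next chamber shares all but one vertex with `x`, and type
    -- preservation makes `g⁻¹ * g'` fix the shared vertices.
    have hex : ∃ l, ∀ k, k ≠ l → (g⁻¹ * g') • x k = x k := by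
      have h1 : ((Finset.univ.image x) \ ((g⁻¹ * g') • Finset.univ.image x)).card = 1 := by
        have := Finset.card_sdiff_add_card_inter (Finset.univ.image x)
          ((g⁻¹ * g') • Finset.univ.image x)
        rw [hx.card_image h] at this
        omega
      obtain ⟨y, hy⟩ := Finset.card_eq_one.mp h1
      have hy' := Finset.mem_sdiff.mp (hy ▸ Finset.mem_singleton_self y)
      obtain ⟨l, -, rfl⟩ := Finset.mem_image.mp hy'.1
      refine ⟨l, fun k hk => hx.smul_eq_of_mem h ?_⟩
      by_contra hc
      have : x k ∈ Finset.univ.image x \ ((g⁻¹ * g') • Finset.univ.image x) :=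
        Finset.mem_sdiff.mpr ⟨by simp, hc⟩
      rw [hy, Finset.mem_singleton] at this
      exact hk (hx.injective h this)
    obtain ⟨l, hl⟩ := hex
    have h1 := hv l _ hl
    have h2 := ih g rfl
    calc π g' v = π (g * (g⁻¹ * g')) v := by rw [mul_inv_cancel_left]
      _ = π g (π (g⁻¹ * g') v) := by rw [map_mul]; rfl
      _ = v := by rw [h1, h2]

variable [CompleteSpace H]

/-- A vector `φ (x i)` in the span of the others is fixed by every panel stabilizer: directly if the
panel contains `x i`, through the span if it does not. -/
theorem linearIndependent_of_isEquivariantEmbedding (h : IsBPair G X S) (hn : 2 ≤ n)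
    (hx : IsChamber X S x) {π : G →* (H ≃ₗᵢ[ℂ] H)} (hπ : NoInvariantVectors π) {φ : V → H}
    (hφ : IsEquivariantEmbedding π x φ) : LinearIndependent ℂ (fun i => φ (x i)) := by
  rw [linearIndependent_iff_notMem_span]
  intro i hi
  have h0 : φ (x i) = 0 := by
    refine hπ _ (invariant_of_fixed_panels h hn hx π fun l g hg => ?_)
    by_cases hil : i = l
    · subst hil
      refine Submodule.span_induction (p := fun y _ => π g y = y) ?_ (map_zero _) ?_ ?_ hi
      · rintro _ ⟨k, hk, rfl⟩
        rw [← hφ.equivariant, hg k hk.2]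
      · intro a b _ _ ha hb
        rw [map_add, ha, hb]
      · intro c a _ ha
        rw [map_smul, ha]
    · rw [← hφ.equivariant, hg i hil]
  have h1 := hφ.norm_eq (x i)
  rw [h0, norm_zero] at h1
  exact zero_ne_one h1

end Generation

/-! ### Equivariant functions on a finite graph and angles. -/

section Angle

open scoped InnerProductSpace

variable {H : Type*} [NormedAddCommGroup H] [InnerProductSpace ℂ H]

/-- A bound for all multiples of two vectors bounds the cosine of their angle. -/
theorem norm_inner_le_of_forall_smul {a b : H} {l : ℝ}
    (h : ∀ α β : ℂ, 2 * (⟪α • a, β • b⟫_ℂ).re ≤ l * (‖α • a‖ ^ 2 + ‖β • b‖ ^ 2)) :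
    ‖⟪a, b⟫_ℂ‖ ≤ l * (‖a‖ * ‖b‖) := by
  by_cases ha : a = 0
  · simp [ha]
  by_cases hb : b = 0
  · simp [hb]
  have ha' : 0 < ‖a‖ := norm_pos_iff.mpr ha
  have hb' : 0 < ‖b‖ := norm_pos_iff.mpr hb
  by_cases h0 : ⟪a, b⟫_ℂ = 0
  · have h1 := h 1 0
    have h2 : 0 ≤ l * ‖a‖ ^ 2 := by simpa using h1
    have h3 : 0 ≤ l := by
      by_contra hc
      push Not at hc
      exact absurd (mul_neg_of_neg_of_pos hc (pow_pos ha' 2)) (not_lt.mpr h2)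
    rw [h0, norm_zero]
    positivity
  have hc' : (0 : ℝ) < ‖⟪a, b⟫_ℂ‖ := norm_pos_iff.mpr h0
  set c := ⟪a, b⟫_ℂ with hc
  -- The phase makes the inner product real and positive; the moduli give both vectors the norm `‖a‖
  -- * ‖b‖`, so nothing is lost in passing from the sum of squares to the product of norms.
  have h1 := h (‖b‖ : ℂ) ((‖a‖ : ℂ) * ((starRingEnd ℂ) c / ‖c‖))
  have h2 : ⟪(‖b‖ : ℂ) • a, ((‖a‖ : ℂ) * ((starRingEnd ℂ) c / ‖c‖)) • b⟫_ℂ =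
      ((‖a‖ * ‖b‖ * ‖c‖ : ℝ) : ℂ) := by
    rw [inner_smul_left, inner_smul_right, ← hc, Complex.conj_ofReal]
    have h3 : (starRingEnd ℂ) c * c = (‖c‖ : ℂ) ^ 2 := Complex.conj_mul' c
    have h4 : (‖c‖ : ℂ) ≠ 0 := by exact_mod_cast hc'.ne'
    push_cast
    field_simp
    linear_combination (‖a‖ : ℂ) * ‖b‖ * h3
  have h5 : ‖((‖a‖ : ℂ) * ((starRingEnd ℂ) c / ‖c‖)) • b‖ = ‖a‖ * ‖b‖ := by
    rw [norm_smul, norm_mul, norm_div, RCLike.norm_conj, Complex.norm_real, Complex.norm_real,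
      norm_norm, norm_norm, div_self hc'.ne', mul_one]
  have h6 : ‖(‖b‖ : ℂ) • a‖ = ‖a‖ * ‖b‖ := by
    rw [norm_smul, Complex.norm_real, norm_norm, mul_comm]
  rw [h2, h5, h6, Complex.ofReal_re] at h1
  refine le_of_mul_le_mul_left ?_ (mul_pos ha' hb')
  nlinarith

variable {G : Type*} [Group G] {W : Type*} [Fintype W] {Γ : SimpleGraph W}
  [DecidableRel Γ.Adj]

/-- An equivariant function on a finite graph with values in the orthogonal complement of the
invariant vectors has mean zero. -/
theorem sum_degree_smul_eq_zero (π : G →* (H ≃ₗᵢ[ℂ] H)) {K : Subgroup G} {Φ : W → H}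
    (hΦ : ∀ v, Φ v ∈ (fixedSubspace π K)ᗮ)
    (haut : ∀ g ∈ K, ∃ e : Γ ≃g Γ, ∀ v, Φ (e v) = π g (Φ v)) :
    ∑ v, ∑ u, Γ.adjMatrix ℂ v u • Φ v = 0 := by
  refine Submodule.disjoint_def.mp (Submodule.orthogonal_disjoint (fixedSubspace π K)) _ ?_
    (Submodule.sum_mem _ fun v _ => Submodule.sum_mem _ fun u _ => Submodule.smul_mem _ _ (hΦ v))
  intro g hg
  obtain ⟨e, he⟩ := haut g hg
  simp only [map_sum, map_smul, ← he]
  rw [← Equiv.sum_comp e.toEquiv (fun v => ∑ u, Γ.adjMatrix ℂ v u • Φ v)]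
  refine Finset.sum_congr rfl fun v _ => ?_
  refine Eq.trans ?_ (Equiv.sum_comp e.toEquiv _)
  refine Finset.sum_congr rfl fun u _ => ?_
  simp [SimpleGraph.adjMatrix_apply, e.map_adj_iff]

/-- When all edges contribute equally, both sides of the spectral gap inequality are multiples of
the number of oriented edges, which cancels. -/
theorem two_mul_le_secondEigenvalue_mul [Nonempty W] (hdeg : ∀ v, ∃ u, Γ.Adj v u)
    (π : G →* (H ≃ₗᵢ[ℂ] H)) {K : Subgroup G} {Φ : W → H}
    (hΦ : ∀ v, Φ v ∈ (fixedSubspace π K)ᗮ)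
    (haut : ∀ g ∈ K, ∃ e : Γ ≃g Γ, ∀ v, Φ (e v) = π g (Φ v)) {r s : ℝ}
    (hr : ∀ v u, Γ.Adj v u → (⟪Φ v, Φ u⟫_ℂ).re = r)
    (hs : ∀ v u, Γ.Adj v u → ‖Φ v‖ ^ 2 + ‖Φ u‖ ^ 2 = s) :
    2 * r ≤ secondEigenvalue Γ * s := by
  let _ : InnerProductSpace ℝ H := InnerProductSpace.rclikeToReal ℂ H
  have hdeg' : ∀ v, 0 < ∑ u, Γ.adjMatrix ℝ v u := by
    intro v
    obtain ⟨u, hu⟩ := hdeg v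
    refine Finset.sum_pos' (fun u _ => adjMatrix_nonneg Γ v u) ⟨u, Finset.mem_univ u, ?_⟩
    rw [SimpleGraph.adjMatrix_apply, if_pos hu]
    exact zero_lt_one
  have hD : 0 < ∑ v, ∑ u, Γ.adjMatrix ℝ v u :=
    Finset.sum_pos (fun v _ => hdeg' v) Finset.univ_nonempty
  have h0 : ∑ v, (∑ u, Γ.adjMatrix ℝ v u) • Φ v = 0 := by
    rw [← sum_degree_smul_eq_zero π hΦ haut]
    refine Finset.sum_congr rfl fun v _ => ?_
    rw [Finset.sum_smul]
    refine Finset.sum_congr rfl fun u _ => ?_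
    simp only [SimpleGraph.adjMatrix_apply]
    split_ifs <;> simp
  have key := sum_adjMatrix_mul_inner_le hdeg' h0
  have h1 : ∑ v, ∑ u, Γ.adjMatrix ℝ v u * inner ℝ (Φ v) (Φ u) =
      (∑ v, ∑ u, Γ.adjMatrix ℝ v u) * r := by
    simp only [Finset.sum_mul]
    refine Finset.sum_congr rfl fun v _ => Finset.sum_congr rfl fun u _ => ?_
    rw [SimpleGraph.adjMatrix_apply]
    split_ifs with hvu
    · rw [← hr v u hvu]; rfl
    · simp
  have h2 : 2 * ∑ v, (∑ u, Γ.adjMatrix ℝ v u) * ‖Φ v‖ ^ 2 =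
      (∑ v, ∑ u, Γ.adjMatrix ℝ v u) * s := by
    have hswap : ∑ v, (∑ u, Γ.adjMatrix ℝ v u) * ‖Φ v‖ ^ 2 =
        ∑ v, ∑ u, Γ.adjMatrix ℝ v u * ‖Φ u‖ ^ 2 := by
      simp only [Finset.sum_mul]
      rw [Finset.sum_comm]
      simp only [adjMatrix_comm Γ]
    rw [two_mul]
    nth_rewrite 2 [hswap]
    simp only [Finset.sum_mul, ← Finset.sum_add_distrib]
    refine Finset.sum_congr rfl fun v _ => Finset.sum_congr rfl fun u _ => ?_
    rw [SimpleGraph.adjMatrix_apply]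
    split_ifs with hvu
    · rw [← hs v u hvu]; ring
    · simp
  rw [h1] at key
  refine le_of_mul_le_mul_left ?_ hD
  calc _ = 2 * ((∑ v, ∑ u, Γ.adjMatrix ℝ v u) * r) := by ring
    _ ≤ 2 * (secondEigenvalue Γ * ∑ v, (∑ u, Γ.adjMatrix ℝ v u) * ‖Φ v‖ ^ 2) := by gcongr
    _ = secondEigenvalue Γ * (2 * ∑ v, (∑ u, Γ.adjMatrix ℝ v u) * ‖Φ v‖ ^ 2) := by ring
    _ = _ := by rw [h2]; ring

variable [CompleteSpace H]

/-- By unitarity, `π g v - v` is orthogonal to every vector fixed by `g`. -/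
theorem starProjection_fixedSubspace_apply (π : G →* (H ≃ₗᵢ[ℂ] H)) {K : Subgroup G} {g : G}
    (hg : g ∈ K) (v : H) :
    (fixedSubspace π K).starProjection (π g v) = (fixedSubspace π K).starProjection v := by
  rw [← sub_eq_zero, ← map_sub, Submodule.starProjection_apply_eq_zero_iff,
    Submodule.mem_orthogonal]
  intro f hf
  have h1 : ⟪f, π g v⟫_ℂ = ⟪f, v⟫_ℂ := by
    conv_lhs => rw [← hf g hg]
    exact (π g).inner_map_map _ _
  rw [inner_sub_right, h1, sub_self]

theorem apply_sub_starProjection (π : G →* (H ≃ₗᵢ[ℂ] H)) {K : Subgroup G} {g : G}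
    (hg : g ∈ K) (v : H) :
    π g v - (fixedSubspace π K).starProjection (π g v) =
      π g (v - (fixedSubspace π K).starProjection v) := by
  rw [starProjection_fixedSubspace_apply π hg, map_sub,
    (Submodule.starProjection_apply_mem (fixedSubspace π K) v) g hg]

end Angle

/-! ### Angles in an equivariant embedding and the coordinate bound. -/

section Embedding

theorem finite_vertices {V : Type*} {K : PreAbstractSimplicialComplex V} (hK : K.faces.Finite) :
    Finite {v : V // {v} ∈ K.faces} := by
  have := hK.to_subtype
  refine Finite.of_injective (β := K.faces) (fun v => ⟨{v.1}, v.2⟩) fun a b hab => ?_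
  exact Subtype.ext (Finset.singleton_injective (congrArg Subtype.val hab))

open scoped InnerProductSpace

variable {V : Type*} [DecidableEq V] {n : ℕ} {G : Type*} [Group G] [MulAction G V]
  {X : AbstractSimplicialComplex V} {S : Fin (n + 1) → Set V} {x : Fin (n + 1) → V}
  {H : Type*} [NormedAddCommGroup H] [InnerProductSpace ℂ H] [CompleteSpace H]

/-- The cosine of the angle between the components of `φ (x i)` and `φ (x j)` orthogonal to the
vectors fixed by the stabilizer of the opposite face is at most `λ i j`. -/
theorem norm_inner_sub_starProjection_le (h : IsBPair G X S) (hn : 2 ≤ n) (hx : IsChamber X S x)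
    (π : G →* (H ≃ₗᵢ[ℂ] H)) {φ : V → H} (hφ : ∀ (g : G) (v : V), φ (g • v) = π g (φ v))
    {i j : Fin (n + 1)} (hij : i ≠ j) {P : H →L[ℂ] H}
    (hP : P = (fixedSubspace π (MulAction.stabilizer G (oppositeFace x i j))).starProjection) :
    ‖⟪φ (x i) - P (φ (x i)), φ (x j) - P (φ (x j))⟫_ℂ‖ ≤
      linkEigenvalue X S i j * (‖φ (x i) - P (φ (x i))‖ * ‖φ (x j) - P (φ (x j))‖) := by
  classical
  have hτ := oppositeFace_mem hn hx i j
  have hc := card_oppositeFace h hx hn hij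
  rw [linkEigenvalue_eq h hτ hc (faceType_oppositeFace h hx i j)]
  set τ := oppositeFace x i j
  have := finite_vertices (h.finite_links τ hτ hc)
  let _ := Fintype.ofFinite {v : V // {v} ∈ (link X τ).faces}
  have : Nonempty {v : V // {v} ∈ (link X τ).faces} := by
    have h1 := smul_pair_mem_link h hx (one_mem (MulAction.stabilizer G (oppositeFace x i j)))
    exact ⟨⟨_, ((link X τ).isRelLowerSet_faces h1).2
      (Finset.singleton_subset_iff.mpr (Finset.mem_insert_self _ _)) (Finset.singleton_nonempty _)⟩⟩
  refine norm_inner_le_of_forall_smul fun α β => ?_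
  -- Vertices of the link lie in `S i` or `S j`, so this weights its two sides by independent
  -- scalars; type preservation keeps `Φ` equivariant.
  let c : V → ℂ := fun v => if v ∈ S i then α else β
  let Φ : V → H := fun v => c v • (φ v - P (φ v))
  have hmove : ∀ g ∈ MulAction.stabilizer G τ, ∀ v, φ (g • v) - P (φ (g • v)) =
      π g (φ v - P (φ v)) := by
    intro g hg v
    rw [hφ, hP, apply_sub_starProjection π hg]
  have hΦi : ∀ g ∈ MulAction.stabilizer G τ, Φ (g • x i) = π g (α • (φ (x i) - P (φ (x i)))) := by
    intro g hg
    simp only [Φ, c]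
    rw [if_pos (hx.smul_mem_side h g i), hmove g hg, map_smul]
  have hΦj : ∀ g ∈ MulAction.stabilizer G τ, Φ (g • x j) = π g (β • (φ (x j) - P (φ (x j)))) := by
    intro g hg
    simp only [Φ, c]
    rw [if_neg fun hi => hij (eq_of_mem_side h hi (hx.smul_mem_side h g j) rfl), hmove g hg,
      map_smul]
  have hface : ∀ v : {v : V // {v} ∈ (link X τ).faces}, {v.1} ∈ X.faces := fun v =>
    (X.isRelLowerSet_faces v.2.2.2).2 Finset.subset_union_left (Finset.singleton_nonempty _)
  refine two_mul_le_secondEigenvalue_mul (Γ := skeletonGraph (link X τ))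
    (exists_adj_link h hx hij) π (K := MulAction.stabilizer G τ) (Φ := fun v => Φ v.1) ?_ ?_ ?_ ?_
  · intro v
    refine Submodule.smul_mem _ _ ?_
    rw [hP]
    exact Submodule.sub_starProjection_mem_orthogonal _
  · intro g hg
    refine ⟨linkAut h hg, fun v => ?_⟩
    change c (g • v.1) • (φ (g • v.1) - P (φ (g • v.1))) = _
    have hcv : c (g • v.1) = c v.1 := by
      have : g • v.1 ∈ S i ↔ v.1 ∈ S i := by
        refine ⟨fun hv => ?_, fun hv => smul_mem_side h g hv (hface v)⟩
        have h1 := smul_mem_side h g⁻¹ hv (by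
          simpa using h.smul_mem g _ (hface v))
        rwa [inv_smul_smul] at h1
      simp only [c, this]
    rw [hcv, hmove g hg, ← map_smul]
  · intro v u hvu
    obtain ⟨g, hg, ⟨hv, hu⟩ | ⟨hv, hu⟩⟩ := exists_smul_eq_of_adj h hn hx hij hvu
    · simp only [hv, hu]
      rw [hΦi g hg, hΦj g hg, (π g).inner_map_map]
    · simp only [hv, hu]
      rw [hΦi g hg, hΦj g hg, (π g).inner_map_map, ← inner_conj_symm, Complex.conj_re]
  · intro v u hvu
    obtain ⟨g, hg, ⟨hv, hu⟩ | ⟨hv, hu⟩⟩ := exists_smul_eq_of_adj h hn hx hij hvu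
    · simp only [hv, hu]
      rw [hΦi g hg, hΦj g hg, (π g).norm_map, (π g).norm_map]
    · simp only [hv, hu]
      rw [hΦi g hg, hΦj g hg, (π g).norm_map, (π g).norm_map, add_comm]

theorem oppositeFace_comm (i j : Fin (n + 1)) : oppositeFace x i j = oppositeFace x j i := by
  rw [oppositeFace, oppositeFace, Finset.pair_comm]

/-- The coordinates of a point with respect to the images of the vertices of a chamber are bounded
in terms of the smallest eigenvalue of the cosine matrix. -/
theorem sqrt_mul_norm_coeff_le (h : IsBPair G X S) (hn : 2 ≤ n) (hx : IsChamber X S x)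
    (hA : (cosineMatrix X S).IsHermitian) {π : G →* (H ≃ₗᵢ[ℂ] H)} (hπ : NoInvariantVectors π)
    {φ : V → H} (hφ : IsEquivariantEmbedding π x φ) (t : Fin (n + 1) → ℂ) (i : Fin (n + 1)) :
    √(⨅ i, hA.eigenvalues i) * ‖t i‖ ≤ ‖∑ k, t k • φ (x k)‖ := by
  set μ := ⨅ i, hA.eigenvalues i
  obtain ⟨u, hu, huv⟩ := exists_dual_family
    (linearIndependent_of_isEquivariantEmbedding h hn hx hπ hφ)
  have hul : ∀ i j, i ≠ j →
      ‖⟪u i, u j⟫_ℂ‖ ≤ linkEigenvalue X S i j * (‖u i‖ * ‖u j‖) := by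
    intro i j hij
    have himg : φ '' (oppositeFace x i j : Set V) = (fun k => φ (x k)) '' {i, j}ᶜ := by
      rw [oppositeFace, Finset.coe_image, Set.image_image, Finset.coe_compl, Finset.coe_insert,
        Finset.coe_singleton]
    refine norm_inner_dual_le (v := fun k => φ (x k)) hu huv
      (F := fixedSubspace π (MulAction.stabilizer G (oppositeFace x i j))) hij ?_ ?_ ?_
      (norm_inner_sub_starProjection_le h hn hx π hφ.equivariant hij rfl)
    · intro k hki hkj g hg
      rw [← hφ.equivariant, hx.smul_eq_of_mem_stabilizer h hg hki hkj]
    · rw [← himg]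
      exact hφ.projection_mem i j hij
    · rw [← himg, oppositeFace_comm]
      exact hφ.projection_mem j i hij.symm
  have hui : μ * ‖u i‖ ^ 2 ≤ 1 := by
    refine norm_dual_le (v := fun k => φ (x k)) (fun k => hφ.norm_eq _) hu huv
      (l := linkEigenvalue X S) ?_ hul i
    intro c
    exact iInf_eigenvalues_mul_le hA c
  have h1 : √μ * ‖u i‖ ≤ 1 := by
    by_cases hμ0 : 0 ≤ μ
    · refine (abs_le_of_sq_le_sq' ?_ zero_le_one).2
      rw [mul_pow, Real.sq_sqrt hμ0, one_pow]
      exact hui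
    · rw [Real.sqrt_eq_zero_of_nonpos (not_le.mp hμ0).le, zero_mul]
      exact zero_le_one
  have h2 : t i = ⟪u i, ∑ k, t k • φ (x k)⟫_ℂ := by
    simp only [inner_sum, inner_smul_right, huv]
    simp
  calc √μ * ‖t i‖ ≤ √μ * (‖u i‖ * ‖∑ k, t k • φ (x k)‖) := by
        gcongr
        rw [h2]
        exact norm_inner_le_norm _ _
    _ = √μ * ‖u i‖ * ‖∑ k, t k • φ (x k)‖ := by ring
    _ ≤ 1 * ‖∑ k, t k • φ (x k)‖ := by gcongr
    _ = _ := one_mul _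

end Embedding

end PartiteComplex

/-! ### The choice of `α` and the conclusion. -/

theorem theoremA4 (n : ℕ) (hn : 2 ≤ n) :
    ∃ α : ℝ → ℝ, (∀ μ, 0 < μ → 0 < α μ) ∧
      ∀ (V : Type*) [DecidableEq V] (G : Type*) [Group G] [MulAction G V]
        (X : AbstractSimplicialComplex V) (S : Fin (n + 1) → Set V),
        PartiteComplex.IsBPair G X S →
        ∀ hA : (PartiteComplex.cosineMatrix X S).PosDef,
        ∀ x : Fin (n + 1) → V, PartiteComplex.IsChamber X S x →
        ∀ (H : Type*) [NormedAddCommGroup H] [InnerProductSpace ℂ H] [CompleteSpace H]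
          (π : G →* (H ≃ₗᵢ[ℂ] H)), PartiteComplex.NoInvariantVectors π →
        ∀ φ : V → H, PartiteComplex.IsEquivariantEmbedding π x φ →
          LinearIndependent ℂ (fun i => φ (x i)) ∧
          ENNReal.ofReal (α (⨅ i, hA.isHermitian.eigenvalues i)) ≤
            PartiteComplex.complexSphericalVolume (fun i => φ (x i)) := by
  have hpi : 0 < √Real.pi := Real.sqrt_pos.mpr Real.pi_pos
  have hΓ : 0 < Real.Gamma (((n + 1 : ℕ) : ℝ) / 2 + 1) := Real.Gamma_pos_of_pos (by positivity)
  -- This is the bound of `le_sphericalVolume` with `m = n + 1` and `δ = √μ`: the dimension times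
  -- the volume of a ball of radius `√μ / (2 * (n + 1))`.
  refine ⟨fun μ => ((n + 1 : ℕ) : ℝ) * ((√μ / (2 * ((n + 1 : ℕ) : ℝ))) ^ (n + 1) *
    (√Real.pi ^ (n + 1) / Real.Gamma (((n + 1 : ℕ) : ℝ) / 2 + 1))), fun μ hμ => ?_, ?_⟩
  · have := Real.sqrt_pos.mpr hμ
    positivity
  intro V _ G _ _ X S h hA x hx H _ _ _ π hπ φ hφ
  refine ⟨PartiteComplex.linearIndependent_of_isEquivariantEmbedding h hn hx hπ hφ, ?_⟩
  have hμ : 0 < ⨅ i, hA.isHermitian.eigenvalues i := by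
    obtain ⟨i, hi⟩ := exists_eq_ciInf_of_finite (f := hA.isHermitian.eigenvalues)
    rw [← hi]
    exact hA.eigenvalues_pos i
  set μ := ⨅ i, hA.isHermitian.eigenvalues i
  let _ : InnerProductSpace ℝ H := InnerProductSpace.rclikeToReal ℂ H
  have key := PartiteComplex.le_sphericalVolume (Nat.succ_pos n) (fun i => φ (x i))
    (fun i => hφ.norm_eq _) (Real.sqrt_pos.mpr hμ) fun t i => by
      have h1 := PartiteComplex.sqrt_mul_norm_coeff_le h hn hx hA.isHermitian hπ hφ
        (fun k => (t k : ℂ)) i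
      rw [Complex.norm_real] at h1
      exact h1
  refine le_trans (le_of_eq ?_) key
  rw [ENNReal.ofReal_mul (by positivity), ENNReal.ofReal_mul (by positivity),
    ENNReal.ofReal_pow (by positivity), ENNReal.ofReal_natCast]
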